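/- Let $W=(Y,X,Z)$ be a random vector with values in $\mathbb{R}\times\mathbb{R}^p\times\mathbb{R}^q$ and law $P$. For a random vector $V$ let $L_2(V)$ be the space of measurable functions $f$ with $E|f(V)|^2<\infty$. *Model.* For a probability law $P$ and a function $g$ write $(P,g)\in\mathcal M$ if, under $P$: $E|Y|<\infty$, $g\in L_2(X)$, $r(Z):=E[Y\mid Z]$ is square integrable, $E[Y\mid Z]=E[g(X)\mid Z]$ a.s., and $E[XX']$ is finite and positive definite. For $(P,g)\in\mathcal M$ put $\beta(P,g)=E[XX']^{-1}E[Xg(X)]$, the coefficient vector of the best linear approximation of $g(X)$ by $X$ in mean square. *Assumptions.* (1) $(P,g)\in\mathcal M$ for some $g$. Let $g_0$ be the solution of minimal $L_2(X)$-norm of $E[Y\mid Z]=E[g(X)\mid Z]$. (2) For $\Omega(Z)=E[(Y-g_0(X))^2\mid Z]$ there are constants $0<c\le C<\infty$ with $c\le\Omega(Z)\le C$ a.s., and the operator $T:L_2(Z)\to L_2(X)$, $Th=E[h(Z)\mid X=\cdot\,]$, is compact. *Regular identification.* A regular submodel is a curve $t\mapsto(P_t,g_t)$, defined for $t$ near $0$,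 with $(P_0,g_0)$ as its value at $t=0$ (where $P_0=P$), such that: $(P_t,g_t)\in\mathcal M$; $t\mapsto P_t$ is differentiable in quadratic mean at $0$ with a score $s\in L_2(P)$, i.e. $\int\bigl(\sqrt{dP_t}-\sqrt{dP}-\tfrac t2 s\sqrt{dP}\bigr)^2=o(t^2)$; $t\mapsto g_t$ is differentiable at $0$ in $L_2(X)$ under $P$; the law of $X$ under $P_t$ has a density with respect to its law under $P$ that is bounded uniformly in $t$; $E_{P_t}[(Y-g_t(X))^2]$ is bounded in $t$; and $t\mapsto\beta(P_t,g_t)$ is differentiable at $0$, with derivative $\dot\beta$. The efficiency bound for $c'\beta$, $c\in\mathbb{R}^p$, is the supremum over all regular submodels of $(c'\dot\beta)^2/E[s(W)^2]$ (with $0/0=0$ and $a/0=\infty$ for $a>0$). The parameter $\beta$ is regularly identified at $P$ if it is identified, i.e. $\beta(P,g)=\beta(P,\tilde g)$ whenever $(P,g),(P,\tilde g)\in\mathcal M$, and has a finite efficiency bound, i.e. the efficiency bound for $c'\beta$ is finite for every $c\in\mathbb{R}^p$. **Lemma 1.** Let Assumptions (1) and (2) hold. If $\beta$ is regularly identified at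 $P$, then there is a measurable $h:\mathbb{R}^q\to\mathbb{R}^p$ with all components in $L_2(Z)$ such that $E[h(Z)\mid X]=X$ a.s. -/

import Mathlib

open MeasureTheory Filter Topology
open scoped ENNReal NNReal Matrix

noncomputable section

namespace OLIVA

/-- The observed vector `W = (Y, X, Z)`, with `Y` real, `X` in `ℝ^p` and `Z` in `ℝ^q`. -/
abbrev Obs (p q : ℕ) : Type := ℝ × (Fin p → ℝ) × (Fin q → ℝ)

variable {p q : ℕ}

/-- The dependent variable. -/
def Y (w : Obs p q) : ℝ := w.1

/-- The vector of regressors. -/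
def X (w : Obs p q) : Fin p → ℝ := w.2.1

/-- The vector of instruments. -/
def Z (w : Obs p q) : Fin q → ℝ := w.2.2

theorem measurable_X : Measurable (X : Obs p q → Fin p → ℝ) :=
  measurable_fst.comp measurable_snd

theorem measurable_Z : Measurable (Z : Obs p q → Fin q → ℝ) :=
  measurable_snd.comp measurable_snd

/-- The sigma-algebra generated by `X`. -/
abbrev sigmaX (p q : ℕ) : MeasurableSpace (Obs p q) := MeasurableSpace.comap X inferInstance

/-- The sigma-algebra generated by `Z`. -/
abbrev sigmaZ (p q : ℕ) : MeasurableSpace (Obs p q) := MeasurableSpace.comap Z inferInstance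

theorem sigmaX_le : sigmaX p q ≤ (inferInstance : MeasurableSpace (Obs p q)) :=
  measurable_X.comap_le

/-- The operator `T : L₂(Z) → L₂(X)`, `T h = E[h(Z) | X]`. Here `L₂(Z)` and `L₂(X)` are realised
as the closed subspaces of `L₂(P)` of the functions measurable with respect to `Z`, resp. `X`. -/
def T (P : Measure (Obs p q)) :
    lpMeas ℝ ℝ (sigmaZ p q) 2 P →L[ℝ] lpMeas ℝ ℝ (sigmaX p q) 2 P :=
  (condExpL2 ℝ ℝ sigmaX_le).comp (lpMeas ℝ ℝ (sigmaZ p q) 2 P).subtypeL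

/-- The matrix `E[X X']`. -/
def secondMoment (P : Measure (Obs p q)) : Matrix (Fin p) (Fin p) ℝ :=
  Matrix.of fun i j => ∫ w, X w i * X w j ∂P

/-- The parameter `β = E[X X']⁻¹ E[X g(X)]`. -/
def beta (P : Measure (Obs p q)) (g : (Fin p → ℝ) → ℝ) : Fin p → ℝ :=
  (secondMoment P)⁻¹ *ᵥ fun j => ∫ w, X w j * g (X w) ∂P

/-- `g ∈ L₂(X)` satisfies the structural equation `E[Y | Z] = E[g(X) | Z]` a.s. -/
structure Solves (P : Measure (Obs p q)) (g : (Fin p → ℝ) → ℝ) : Prop where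
  memLp : MemLp g 2 (P.map X)
  condExp_eq : P[Y | sigmaZ p q] =ᵐ[P] P[fun w => g (X w) | sigmaZ p q]

/-- The statistical model: `P` is the law of an observation `W = (Y, X, Z)` that is generated with
the structural function `g`, where `g ∈ L₂(X)`, `r(Z) = E[Y | Z] ∈ L₂(Z)`, and `E[X X']` is finite
and positive definite. -/
structure InModel (P : Measure (Obs p q)) (g : (Fin p → ℝ) → ℝ) : Prop where
  isProbabilityMeasure : IsProbabilityMeasure P
  integrable_Y : Integrable Y P
  solves : Solves P g
  memLp_r : MemLp (P[Y | sigmaZ p q]) 2 P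
  memLp_X : ∀ j, MemLp (fun w => X w j) 2 P
  posDef : (secondMoment P).PosDef

/-- `g₀` is a solution of minimal `L₂(X)` norm of `E[Y | Z] = E[g(X) | Z]`. -/
structure IsMinNormSolution (P : Measure (Obs p q)) (g₀ : (Fin p → ℝ) → ℝ) : Prop where
  solves : Solves P g₀
  le_norm : ∀ g, Solves P g → eLpNorm g₀ 2 (P.map X) ≤ eLpNorm g 2 (P.map X)

/-- `Ω(Z) = E[(Y - g₀(X))² | Z]` is bounded, and bounded away from zero. -/
def BoundedCondVariance (P : Measure (Obs p q)) (g₀ : (Fin p → ℝ) → ℝ) : Prop :=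
  ∃ c C : ℝ, 0 < c ∧ ∀ᵐ w ∂P,
    c ≤ (P[fun w => (Y w - g₀ (X w)) ^ 2 | sigmaZ p q]) w ∧
      (P[fun w => (Y w - g₀ (X w)) ^ 2 | sigmaZ p q]) w ≤ C

/-- The curve `t ↦ law t` is differentiable in quadratic mean at `t = 0`, with score `s`:
`∫ (√dP_t - √dP - (t/2) s √dP)² = o(t²)`. The square roots of densities are taken with respect to
the dominating measure `P + P_t`; `P_t` need not be dominated by `P`. -/
def IsQMD (P : Measure (Obs p q)) (law : ℝ → Measure (Obs p q)) (s : Obs p q → ℝ) : Prop :=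
  MemLp s 2 P ∧
    Tendsto
      (fun t : ℝ =>
        (∫ w, (√((law t).rnDeriv (P + law t) w).toReal - √(P.rnDeriv (P + law t) w).toReal
            - t / 2 * s w * √(P.rnDeriv (P + law t) w).toReal) ^ 2 ∂(P + law t)) / t ^ 2)
      (𝓝[≠] 0) (𝓝 0)

/-- A regular one-dimensional parametric submodel `t ↦ (P_t, g_t)` through `(P, g₀)`. -/
structure RegularSubmodel (P : Measure (Obs p q)) (g₀ : (Fin p → ℝ) → ℝ) where
  /-- the law of the observation at parameter value `t` -/
  law : ℝ → Measure (Obs p q)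
  /-- the structural function at parameter value `t` -/
  g : ℝ → (Fin p → ℝ) → ℝ
  /-- the score at `t = 0` -/
  score : Obs p q → ℝ
  /-- the derivative of `t ↦ g_t` at `t = 0` -/
  gDot : (Fin p → ℝ) → ℝ
  /-- the derivative of `t ↦ β(P_t, g_t)` at `t = 0` -/
  betaDot : Fin p → ℝ
  law_zero : law 0 = P
  g_zero : g 0 = g₀
  inModel : ∀ᶠ t in 𝓝 (0 : ℝ), InModel (law t) (g t)
  /-- the law of `X` under `P_t` has a density with respect to the one under `P` that is bounded,
  uniformly in `t`; in particular `L₂(X)` under `P` is contained in `L₂(X)` under `P_t` -/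
  map_X_le : ∃ C : ℝ≥0, ∀ᶠ t in 𝓝 (0 : ℝ), (law t).map X ≤ C • P.map X
  /-- the structural errors `Y - g_t(X)` have locally bounded second moments -/
  error_bound : ∃ C : ℝ≥0, ∀ᶠ t in 𝓝 (0 : ℝ), eLpNorm (fun w => Y w - g t (X w)) 2 (law t) ≤ C
  qmd : IsQMD P law score
  /-- `t ↦ g_t` is differentiable at `t = 0` in `L₂(X)` -/
  memLp_gDot : MemLp gDot 2 (P.map X)
  tendsto_g : Tendsto (fun t : ℝ => eLpNorm (fun x => (g t x - g₀ x) / t - gDot x) 2 (P.map X))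
    (𝓝[≠] 0) (𝓝 0)
  hasDerivAt_beta : HasDerivAt (fun t => beta (law t) (g t)) betaDot 0

/-- The semiparametric efficiency bound for the scalar parameter `c'β`: the supremum over all
regular parametric submodels of the Cramér-Rao bound `(c' β̇)² / E[s²]`. (In `[0, ∞]`, `a / 0 = ∞`
for `a ≠ 0` and `0 / 0 = 0`.) -/
def efficiencyBound (P : Measure (Obs p q)) (g₀ : (Fin p → ℝ) → ℝ) (c : Fin p → ℝ) : ℝ≥0∞ :=
  ⨆ S : RegularSubmodel P g₀,
    ENNReal.ofReal ((c ⬝ᵥ S.betaDot) ^ 2) / ENNReal.ofReal (∫ w, S.score w ^ 2 ∂P)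

/-- `β` is regularly identified at `P`: it takes the same value at all structural functions that
are compatible with `P`, and the efficiency bound of each linear combination of its components is
finite. -/
structure RegularlyIdentified (P : Measure (Obs p q)) (g₀ : (Fin p → ℝ) → ℝ) : Prop where
  identified : ∀ g g', InModel P g → InModel P g' → beta P g = beta P g'
  finite_bound : ∀ c : Fin p → ℝ, efficiencyBound P g₀ c < ⊤

end OLIVA

end

/-! Write `ε = Y - G(X)`, where `G` is a measurable version of `g₀`. The core is the inequality
`|E[X_j δ(X)]| ≤ K ‖E[δ(X) | Z]‖₂` for all bounded measurable `δ` (`exists_abs_integral_le`). It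
says that the functional `δ ↦ E[X_j δ(X)]` factors boundedly through `δ ↦ E[δ(X) | Z]`. The Riesz
representation theorem then gives `h` with `E[X_j δ(X)] = E[h E[δ(X) | Z]] = E[E[h | Z] δ(X)]`.
Letting `δ` run through indicators, `X_j = E[E[h | Z] | X]` (`exists_condExp_eq`).

The inequality comes from submodels with `g_t = G + t δ`. To first order the conditional moment
restriction demands `E[s ε | Z] = E[δ(X) | Z]`. The score `s = E[δ(X) | Z] ε / Ω(Z)` satisfies this,
and its norm is at most a constant times that of `E[δ(X) | Z]`, because `Ω` is bounded below
(`exists_score`). The model must hold exactly for each small `t`, so `P` is reweighted by `1 + t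
σ_t`, with `σ_t` bounded and tending to `s`, and a share `t² |resid|` of the mass has its `Y` moved
to distance `1/|t|` from `G(X)`. This shifts the conditional moment by `-t resid`, exactly
cancelling the error. As `resid → 0` in `L₁`, the moved mass is `o(t²)` and does not affect the
score (`IsScoreFamily.isQMD`).

Along such a curve `E[XX'] β̇ = E[X δ(X)] + v`, where `v = lim E[X (G(X) - X'β) σ_t]`. Since `X_j
(G(X) - X'β)` is merely integrable, `v` is not a function of `s` a priori. If `σ ↦ E[X (G(X) - X'β)
σ]` were unbounded for the `L₂` norm, normalising would produce a submodel with score zero and `β̇ ≠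
0`, hence an infinite bound (`exists_norm_scoreMoment_le`). So `v` is of order `‖s‖₂`. The finite
bound controls `E[X_j δ(X)] + v_j` by `‖s‖₂` as well, and subtracting gives the inequality. -/

noncomputable section

namespace OLIVA

/-! ### Factoring a dominated functional through a Hilbert space -/

/-- A linear functional that is dominated by a linear map into a Hilbert space factors through
that map. -/
theorem exists_inner_eq_of_abs_le {V H : Type*} [AddCommGroup V] [Module ℝ V]
    [NormedAddCommGroup H] [InnerProductSpace ℝ H] [CompleteSpace H] (S : V →ₗ[ℝ] H)
    (l : V →ₗ[ℝ] ℝ) (K : ℝ) (h : ∀ v, |l v| ≤ K * ‖S v‖) :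
    ∃ y : H, ∀ v, inner ℝ y (S v) = l v := by
  have hker : LinearMap.ker S ≤ LinearMap.ker l := by
    intro v hv
    rw [LinearMap.mem_ker] at hv ⊢
    have := h v
    rw [hv, norm_zero, mul_zero] at this
    exact abs_eq_zero.mp (le_antisymm this (abs_nonneg _))
  let φ : LinearMap.range S →ₗ[ℝ] ℝ :=
    ((LinearMap.ker S).liftQ l hker).comp S.quotKerEquivRange.symm.toLinearMap
  have hφ : ∀ v, φ ⟨S v, LinearMap.mem_range_self S v⟩ = l v := by
    intro v
    have : S.quotKerEquivRange.symm ⟨S v, LinearMap.mem_range_self S v⟩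
        = (LinearMap.ker S).mkQ v := by
      rw [LinearEquiv.symm_apply_eq]
      rfl
    simp only [φ, LinearMap.comp_apply, LinearEquiv.coe_coe, this]
    rfl
  have hb : ∀ x : LinearMap.range S, ‖φ x‖ ≤ K * ‖x‖ := by
    rintro ⟨_, v, rfl⟩
    rw [hφ v]
    exact h v
  -- The range of `S` need not be closed, so the functional is first extended to all of `H` by
  -- Hahn–Banach and only then represented by a vector.
  obtain ⟨ψ, hψ, -⟩ := exists_extension_norm_eq (LinearMap.range S) (φ.mkContinuous K hb)
  refine ⟨(InnerProductSpace.toDual ℝ H).symm ψ, fun v => ?_⟩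
  rw [InnerProductSpace.toDual_symm_apply, ← hφ v]
  exact hψ ⟨S v, LinearMap.mem_range_self S v⟩

/-! ### Reweighted laws with a transported part, and their Hellinger remainder -/

section MixedLaw

variable {Ω : Type*} [MeasurableSpace Ω]

/-- The measure `P` reweighted by `a`, plus the image under `F` of `P` reweighted by `r`. -/
def mixedLaw (P : Measure Ω) (a r : Ω → ℝ) (F : Ω → Ω) : Measure Ω :=
  P.withDensity (fun w => ENNReal.ofReal (a w)) +
    (P.withDensity (fun w => ENNReal.ofReal (r w))).map F

variable {P : Measure Ω} {a r : Ω → ℝ} {F : Ω → Ω}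

theorem integrable_withDensity_ofReal_iff (ha : Measurable a) (ha0 : 0 ≤ᵐ[P] a) {f : Ω → ℝ} :
    Integrable f (P.withDensity fun w => ENNReal.ofReal (a w)) ↔
      Integrable (fun w => a w * f w) P := by
  rw [integrable_withDensity_iff_integrable_smul' ha.ennreal_ofReal (by simp)]
  refine integrable_congr ?_
  filter_upwards [ha0] with w hw
  simp [ENNReal.toReal_ofReal hw]

theorem integral_withDensity_ofReal (ha : Measurable a) (ha0 : 0 ≤ᵐ[P] a) (f : Ω → ℝ) :
    ∫ w, f w ∂(P.withDensity fun w => ENNReal.ofReal (a w)) = ∫ w, a w * f w ∂P := by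
  rw [integral_withDensity_eq_integral_toReal_smul ha.ennreal_ofReal (by simp)]
  refine integral_congr_ae ?_
  filter_upwards [ha0] with w hw
  simp [ENNReal.toReal_ofReal hw]

theorem integrable_mixedLaw (ha : Measurable a) (ha0 : 0 ≤ᵐ[P] a) (hr : Measurable r)
    (hr0 : 0 ≤ᵐ[P] r) (hF : Measurable F) {f : Ω → ℝ} (hf : Measurable f)
    (h₁ : Integrable (fun w => a w * f w) P) (h₂ : Integrable (fun w => r w * f (F w)) P) :
    Integrable f (mixedLaw P a r F) := by
  refine Integrable.add_measure ?_ ?_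
  · rwa [integrable_withDensity_ofReal_iff ha ha0]
  · rw [integrable_map_measure hf.aestronglyMeasurable hF.aemeasurable]
    exact (integrable_withDensity_ofReal_iff hr hr0).2 h₂

theorem integral_mixedLaw (ha : Measurable a) (ha0 : 0 ≤ᵐ[P] a) (hr : Measurable r)
    (hr0 : 0 ≤ᵐ[P] r) (hF : Measurable F) {f : Ω → ℝ} (hf : Measurable f)
    (h₁ : Integrable (fun w => a w * f w) P) (h₂ : Integrable (fun w => r w * f (F w)) P) :
    ∫ w, f w ∂(mixedLaw P a r F) = ∫ w, a w * f w ∂P + ∫ w, r w * f (F w) ∂P := by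
  rw [mixedLaw, integral_add_measure, integral_withDensity_ofReal ha ha0,
    integral_map hF.aemeasurable hf.aestronglyMeasurable, integral_withDensity_ofReal hr hr0]
  · rwa [integrable_withDensity_ofReal_iff ha ha0]
  · rw [integrable_map_measure hf.aestronglyMeasurable hF.aemeasurable]
    exact (integrable_withDensity_ofReal_iff hr hr0).2 h₂

/-- A map that `F` leaves invariant has the same law under the mixture as under `P` reweighted by
`a + r`. -/
theorem map_mixedLaw {β : Type*} [MeasurableSpace β] {φ : Ω → β} (hφ : Measurable φ)
    (hF : Measurable F) (hφF : ∀ w, φ (F w) = φ w) (ha : Measurable a) (ha0 : 0 ≤ᵐ[P] a)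
    (hr0 : 0 ≤ᵐ[P] r) :
    (mixedLaw P a r F).map φ =
      (P.withDensity fun w => ENNReal.ofReal (a w + r w)).map φ := by
  have h : (P.withDensity fun w => ENNReal.ofReal (a w + r w)) =
      P.withDensity (fun w => ENNReal.ofReal (a w)) +
        P.withDensity (fun w => ENNReal.ofReal (r w)) := by
    rw [← withDensity_add_left ha.ennreal_ofReal]
    refine withDensity_congr_ae ?_
    filter_upwards [ha0, hr0] with w h₁ h₂
    exact ENNReal.ofReal_add h₁ h₂
  have hc : φ ∘ F = φ := funext hφF
  rw [h, mixedLaw, Measure.map_add _ _ hφ, Measure.map_add _ _ hφ, Measure.map_map hφ hF, hc]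

/-- The squared Hellinger-type remainder of a mixture is controlled by the total mass of the
transported part and by the remainder of the reweighted part. -/
theorem integral_sqrt_rnDeriv_mixedLaw_le [IsFiniteMeasure P] (ha : Measurable a)
    (hai : Integrable a P) (hr : Measurable r) (hr0 : 0 ≤ᵐ[P] r)
    (hri : Integrable r P) (hF : Measurable F) (b : Ω → ℝ)
    (hb : Integrable (fun w => (√(a w) - 1 - b w) ^ 2) P) :
    ∫ w, (√((mixedLaw P a r F).rnDeriv (P + mixedLaw P a r F) w).toReal
        - √(P.rnDeriv (P + mixedLaw P a r F) w).toReal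
        - b w * √(P.rnDeriv (P + mixedLaw P a r F) w).toReal) ^ 2 ∂(P + mixedLaw P a r F)
      ≤ 2 * ∫ w, r w ∂P + 2 * ∫ w, (√(a w) - 1 - b w) ^ 2 ∂P := by
  have hfin : ∀ {c : Ω → ℝ}, Integrable c P →
      IsFiniteMeasure (P.withDensity fun w => ENNReal.ofReal (c w)) := fun hc =>
    isFiniteMeasure_withDensity (hc.lintegral_lt_top).ne
  have := hfin hai
  have := hfin hri
  set Pa := P.withDensity fun w => ENNReal.ofReal (a w) with hPa
  set μ := (P.withDensity fun w => ENNReal.ofReal (r w)).map F with hμ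
  have hQ : mixedLaw P a r F = Pa + μ := rfl
  have hQf : IsFiniteMeasure (mixedLaw P a r F) := by rw [hQ]; infer_instance
  set Q := mixedLaw P a r F with hQdef
  set ν := P + Q with hν
  have hPν : P ≪ ν := Measure.absolutelyContinuous_of_le (Measure.le_add_right le_rfl)
  have hμν : μ ≪ ν := Measure.absolutelyContinuous_of_le
    (by rw [hν, hQ]; exact Measure.le_add_left (Measure.le_add_left le_rfl))
  -- With `f` and `m` the densities of `P` and of the transported part, the law has density `a f +
  -- m`. The transported part may be singular to `P`, which is why everything is computed against
  -- `ν`.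
  have e1 : Q.rnDeriv ν =ᵐ[ν] Pa.rnDeriv ν + μ.rnDeriv ν := by
    have := Measure.rnDeriv_add' Pa μ ν
    rwa [← hQ] at this
  have e2 : Pa.rnDeriv ν =ᵐ[ν] fun w => ENNReal.ofReal (a w) * P.rnDeriv ν w :=
    Measure.rnDeriv_withDensity_left ha.ennreal_ofReal.aemeasurable (by simp)
  have i1 : Integrable (fun w => (μ.rnDeriv ν w).toReal) ν := Measure.integrable_toReal_rnDeriv
  have i2 : Integrable (fun w => (P.rnDeriv ν w).toReal • (√(a w) - 1 - b w) ^ 2) ν :=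
    (integrable_rnDeriv_smul_iff hPν).2 hb
  have v1 : ∫ w, (μ.rnDeriv ν w).toReal ∂ν = ∫ w, r w ∂P := by
    rw [Measure.integral_toReal_rnDeriv hμν]
    have : ∫ w, (1:ℝ) ∂μ = ∫ w, r w ∂P := by
      rw [hμ, integral_map hF.aemeasurable (by fun_prop), integral_withDensity_ofReal hr hr0]
      simp
    simpa using this
  have v2 := integral_rnDeriv_smul hPν (f := fun w => (√(a w) - 1 - b w) ^ 2)
  rw [← v1, ← v2, ← integral_const_mul, ← integral_const_mul, ← integral_add (i1.const_mul 2)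
    (i2.const_mul 2)]
  refine integral_mono_of_nonneg (Eventually.of_forall fun w => sq_nonneg _)
    ((i1.const_mul 2).add (i2.const_mul 2)) ?_
  filter_upwards [e1, e2, Measure.rnDeriv_lt_top P ν, Measure.rnDeriv_lt_top μ ν] with w h1 h2 h3 h4
  rw [h1, Pi.add_apply, h2, ENNReal.toReal_add (by finiteness) h4.ne, ENNReal.toReal_mul]
  set f := (P.rnDeriv ν w).toReal
  set m := (μ.rnDeriv ν w).toReal
  have hf : 0 ≤ f := ENNReal.toReal_nonneg
  have hm : 0 ≤ m := ENNReal.toReal_nonneg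
  -- No sign condition on `a` is needed: both sides vanish where `a` is negative.
  have hs : √((ENNReal.ofReal (a w)).toReal) = √(a w) := by
    rcases le_total 0 (a w) with h | h
    · rw [ENNReal.toReal_ofReal h]
    · rw [ENNReal.ofReal_of_nonpos h, Real.sqrt_eq_zero_of_nonpos h]; simp
  set A := (ENNReal.ofReal (a w)).toReal
  have hA : 0 ≤ A := ENNReal.toReal_nonneg
  have k1 : √(A * f + m) ≤ √(A * f) + √m := by
    refine Real.sqrt_le_iff.2 ⟨by positivity, ?_⟩
    have h₁ : √(A * f) ^ 2 = A * f := Real.sq_sqrt (mul_nonneg hA hf)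
    have h₂ : √m ^ 2 = m := Real.sq_sqrt hm
    nlinarith [Real.sqrt_nonneg (A * f), Real.sqrt_nonneg m,
      mul_nonneg (Real.sqrt_nonneg (A * f)) (Real.sqrt_nonneg m)]
  have k2 : √(A * f) ≤ √(A * f + m) := Real.sqrt_le_sqrt (by linarith)
  have k3 : √(A * f) = √(a w) * √f := by rw [Real.sqrt_mul hA, hs]
  have k4 : √m ^ 2 = m := Real.sq_sqrt hm
  have k5 : √f ^ 2 = f := Real.sq_sqrt hf
  set D := √(A * f + m) - √(A * f)
  -- Subadditivity of the square root: adding `m` under the root changes it by at most `√m`.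
  have hD : D ^ 2 ≤ m := by
    rw [← k4]
    exact pow_le_pow_left₀ (by simp only [D]; linarith) (by simp only [D]; linarith) 2
  have key : √(A * f + m) - √f - b w * √f = D + √f * (√(a w) - 1 - b w) := by
    simp only [D, k3]; ring
  rw [key]
  have : (D + √f * (√(a w) - 1 - b w)) ^ 2 ≤ 2 * D ^ 2 + 2 * (√f * (√(a w) - 1 - b w)) ^ 2 := by
    nlinarith [sq_nonneg (D - √f * (√(a w) - 1 - b w))]
  simp only [smul_eq_mul]
  rw [mul_pow, k5] at this
  linarith

end MixedLaw

/-- The remainder in the expansion of the square root at `1`. -/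
theorem abs_sqrt_one_add_sub_le {y : ℝ} (hy : -1 ≤ y) : |√(1 + y) - 1 - y / 2| ≤ y ^ 2 / 2 := by
  have h1 : √(1 + y) ^ 2 = 1 + y := Real.sq_sqrt (by linarith)
  have h0 : 0 ≤ √(1 + y) := Real.sqrt_nonneg _
  generalize √(1 + y) = x at h0 h1 ⊢
  obtain rfl : y = x ^ 2 - 1 := by linarith
  rw [abs_le]
  constructor
  · nlinarith [mul_nonneg h0 (sq_nonneg (x-1)), mul_nonneg (mul_nonneg h0 h0) (sq_nonneg (x-1))]
  · nlinarith [sq_nonneg (x-1), sq_nonneg (x ^ 2 - 1)]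

end OLIVA

/-! ### The perturbed law at a fixed parameter value -/

namespace OLIVA

variable {p q : ℕ}

theorem sigmaZ_le : sigmaZ p q ≤ (inferInstance : MeasurableSpace (Obs p q)) :=
  measurable_Z.comap_le

theorem measurable_Y : Measurable (Y : Obs p q → ℝ) := measurable_fst

theorem dotProduct_secondMoment_mulVec {Q : Measure (Obs p q)}
    (hX : ∀ j, MemLp (fun w => X w j) 2 Q) (c : Fin p → ℝ) :
    c ⬝ᵥ (secondMoment Q *ᵥ c) = ∫ w, (c ⬝ᵥ X w) ^ 2 ∂Q := by
  have hi : ∀ i j, Integrable (fun w => c i * (X w i * X w j * c j)) Q := fun i j =>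
    (((hX i).integrable_mul (hX j)).mul_const _).const_mul _
  have : ∀ w : Obs p q, (c ⬝ᵥ X w) ^ 2 = ∑ i, ∑ j, c i * (X w i * X w j * c j) := by
    intro w
    rw [sq, dotProduct, Finset.sum_mul_sum]
    exact Finset.sum_congr rfl fun i _ => Finset.sum_congr rfl fun j _ => by ring
  simp_rw [this]
  rw [integral_finsetSum _ fun i _ => integrable_finsetSum _ fun j _ => hi i j]
  simp only [dotProduct, Matrix.mulVec, secondMoment, Matrix.of_apply]
  refine Finset.sum_congr rfl fun i _ => ?_
  rw [integral_finsetSum _ fun j _ => hi i j, Finset.mul_sum]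
  refine Finset.sum_congr rfl fun j _ => ?_
  rw [integral_const_mul, integral_mul_const]

/-- The conditional moment, per unit of `t`, of the structural error `Y - G(X) - t δ(X)` under `P`
reweighted by `1 + t s`. -/
def resid (P : Measure (Obs p q)) (G δ : (Fin p → ℝ) → ℝ) (s : Obs p q → ℝ) (t : ℝ) :
    Obs p q → ℝ :=
  P[fun w => s w * (Y w - G (X w)) - δ (X w) - t * s w * δ (X w) | sigmaZ p q]

/-- The share of the mass that is moved by `kickMap`. -/
def kickWeight (P : Measure (Obs p q)) (G δ : (Fin p → ℝ) → ℝ) (s : Obs p q → ℝ) (t : ℝ)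
    (w : Obs p q) : ℝ :=
  t ^ 2 * |resid P G δ s t w|

/-- Moves `Y` at distance `1 / t` from `G(X)`, in the direction that counteracts `resid`. -/
def kickMap (P : Measure (Obs p q)) (G δ : (Fin p → ℝ) → ℝ) (s : Obs p q → ℝ) (t : ℝ)
    (w : Obs p q) : Obs p q :=
  (G (X w) - resid P G δ s t w / |resid P G δ s t w| / t, X w, Z w)

/-- The law `P` reweighted by `1 + t s`, with a small share of its mass moved so as to restore the
conditional moment restriction for the structural function `G + t δ`. -/
def perturbedLaw (P : Measure (Obs p q)) (G δ : (Fin p → ℝ) → ℝ) (s : Obs p q → ℝ) (t : ℝ) :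
    Measure (Obs p q) :=
  mixedLaw P (fun w => 1 + t * s w - kickWeight P G δ s t w) (kickWeight P G δ s t)
    (kickMap P G δ s t)

/-- The reweighting and the share of moved mass are small enough to give a probability law. -/
structure IsSmallPerturbation (P : Measure (Obs p q)) (G δ : (Fin p → ℝ) → ℝ) (D : ℝ)
    (s : Obs p q → ℝ) (t : ℝ) : Prop where
  measurable_G : Measurable G
  measurable_δ : Measurable δ
  abs_δ_le : ∀ x, |δ x| ≤ D
  measurable_s : Measurable s
  abs_mul_le : ∀ w, |t * s w| ≤ 1 / 4
  integral_s : ∫ w, s w ∂P = 0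
  ne_zero : t ≠ 0
  kickWeight_le : ∀ᵐ w ∂P, kickWeight P G δ s t w ≤ 1 / 4

variable {P : Measure (Obs p q)} {G δ : (Fin p → ℝ) → ℝ} {D : ℝ} {s : Obs p q → ℝ} {t : ℝ}

theorem measurable_resid : Measurable (resid P G δ s t) :=
  (stronglyMeasurable_condExp.mono sigmaZ_le).measurable

theorem measurable_kickWeight : Measurable (kickWeight P G δ s t) := by
  have := measurable_resid (P := P) (G := G) (δ := δ) (s := s) (t := t)
  unfold kickWeight
  fun_prop

theorem kickWeight_nonneg (w : Obs p q) : 0 ≤ kickWeight P G δ s t w := by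
  unfold kickWeight
  positivity

theorem measurable_kickMap (hG : Measurable G) : Measurable (kickMap P G δ s t) := by
  have := measurable_resid (P := P) (G := G) (δ := δ) (s := s) (t := t)
  have h1 := measurable_X (p := p) (q := q)
  have h2 := measurable_Z (p := p) (q := q)
  unfold kickMap
  fun_prop

theorem error_kickMap (w : Obs p q) : Y (kickMap P G δ s t w) -
    (G (X (kickMap P G δ s t w)) + t * δ (X (kickMap P G δ s t w))) =
      -(resid P G δ s t w / |resid P G δ s t w| / t + t * δ (X w)) := by
  simp only [kickMap, Y, X]
  ring

theorem integrable_kickWeight : Integrable (kickWeight P G δ s t) P :=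
  (integrable_condExp.abs).const_mul _

namespace IsSmallPerturbation

theorem abs_s_le (h : IsSmallPerturbation P G δ D s t) (w : Obs p q) : |s w| ≤ 1 / (4 * |t|) := by
  have ht : 0 < |t| := abs_pos.2 h.ne_zero
  rw [le_div_iff₀ (by positivity)]
  have := h.abs_mul_le w
  rw [abs_mul] at this
  linarith

theorem D_nonneg (h : IsSmallPerturbation P G δ D s t)
    : 0 ≤ D := (abs_nonneg _).trans (h.abs_δ_le 0)

theorem measurable_density (h : IsSmallPerturbation P G δ D s t)
    : Measurable fun w => 1 + t * s w - kickWeight P G δ s t w := by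
  have := measurable_kickWeight (P := P) (G := G) (δ := δ) (s := s) (t := t)
  have := h.measurable_s
  fun_prop

theorem density_bounds (h : IsSmallPerturbation P G δ D s t)
    : ∀ᵐ w ∂P, 1 / 2 ≤ 1 + t * s w - kickWeight P G δ s t w ∧
    1 + t * s w - kickWeight P G δ s t w ≤ 2 := by
  filter_upwards [h.kickWeight_le] with w hw
  have h1 := abs_le.1 (h.abs_mul_le w)
  have h2 := kickWeight_nonneg (P := P) (G := G) (δ := δ) (s := s) (t := t) w
  constructor <;> linarith [h1.1, h1.2]

theorem density_nonneg (h : IsSmallPerturbation P G δ D s t)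
    : 0 ≤ᵐ[P] fun w => 1 + t * s w - kickWeight P G δ s t w := by
  filter_upwards [h.density_bounds] with w hw
  exact le_trans (by norm_num) hw.1

theorem integrable_s (h : IsSmallPerturbation P G δ D s t) [IsFiniteMeasure P] : Integrable s P :=
  Integrable.of_bound h.measurable_s.aestronglyMeasurable _ (Eventually.of_forall h.abs_s_le)

theorem integrable_density (h : IsSmallPerturbation P G δ D s t) [IsFiniteMeasure P] :
    Integrable (fun w => 1 + t * s w - kickWeight P G δ s t w) P :=
  ((integrable_const 1).add (h.integrable_s.const_mul t)).sub integrable_kickWeight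

theorem isProbabilityMeasure (h : IsSmallPerturbation P G δ D s t) [IsProbabilityMeasure P] :
    IsProbabilityMeasure (perturbedLaw P G δ s t) := by
  have hF := measurable_kickMap (P := P) (δ := δ) (s := s) (t := t) h.measurable_G
  have i1 : Integrable (fun _ : Obs p q => (1 : ℝ)) (perturbedLaw P G δ s t) :=
    integrable_mixedLaw h.measurable_density h.density_nonneg measurable_kickWeight
      (Eventually.of_forall kickWeight_nonneg) hF measurable_const
      (by simpa using h.integrable_density) (by simpa using integrable_kickWeight)
  have i2 : ∫ _, (1 : ℝ) ∂(perturbedLaw P G δ s t) = 1 := by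
    rw [perturbedLaw, integral_mixedLaw h.measurable_density h.density_nonneg
      measurable_kickWeight (Eventually.of_forall kickWeight_nonneg) hF measurable_const
      (by simpa using h.integrable_density) (by simpa using integrable_kickWeight)]
    simp only [mul_one]
    have i3 : Integrable (fun w => 1 + t * s w) P :=
      (integrable_const 1).add (h.integrable_s.const_mul t)
    rw [integral_sub i3 integrable_kickWeight,
      integral_add (integrable_const 1) (h.integrable_s.const_mul t), integral_const_mul,
      h.integral_s]
    simp
  constructor
  rw [integral_const, smul_eq_mul, mul_one, measureReal_def] at i2
  exact (ENNReal.toReal_eq_one_iff _).1 i2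

/-- The kick changes only `Y`, so the moved mass returns to the same place in the `X` marginal and
the kick weight drops out. Hence moments of `X` can be computed without reference to the correction.
-/
theorem map_X_perturbedLaw (h : IsSmallPerturbation P G δ D s t) : (perturbedLaw P G δ s t).map X =
    (P.withDensity fun w => ENNReal.ofReal (1 + t * s w)).map X := by
  rw [perturbedLaw, map_mixedLaw measurable_X (measurable_kickMap h.measurable_G) (fun w => rfl)
    h.measurable_density h.density_nonneg (Eventually.of_forall kickWeight_nonneg)]
  simp

theorem one_add_nonneg (h : IsSmallPerturbation P G δ D s t) (w : Obs p q) : 0 ≤ 1 + t * s w := by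
  have h1 := abs_le.1 (h.abs_mul_le w)
  linarith [h1.1]

theorem map_X_le (h : IsSmallPerturbation P G δ D s t)
    : (perturbedLaw P G δ s t).map X ≤ (2 : ℝ≥0) • P.map X := by
  rw [h.map_X_perturbedLaw, ← Measure.map_smul]
  refine Measure.map_mono ?_ measurable_X
  have : ((2 : ℝ≥0) • P) = P.withDensity fun _ => 2 := by
    rw [withDensity_const]; rfl
  rw [this]
  refine withDensity_mono (Eventually.of_forall fun w => ?_)
  rw [← ENNReal.ofReal_ofNat 2]
  refine ENNReal.ofReal_le_ofReal ?_
  have h1 := abs_le.1 (h.abs_mul_le w)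
  linarith [h1.2]

theorem memLp_comp_X (h : IsSmallPerturbation P G δ D s t)
    {φ : (Fin p → ℝ) → ℝ} (hφ : Measurable φ) {r : ℝ≥0∞}
    (hi : MemLp (fun w => φ (X w)) r P) : MemLp (fun w => φ (X w)) r (perturbedLaw P G δ s t) := by
  have h1 : MemLp φ r (P.map X) :=
    (memLp_map_measure_iff hφ.aestronglyMeasurable measurable_X.aemeasurable).2 hi
  have h2 : MemLp φ r ((perturbedLaw P G δ s t).map X) :=
    MemLp.of_measure_le_smul (c := 2) (by simp) h.map_X_le h1
  exact (memLp_map_measure_iff hφ.aestronglyMeasurable measurable_X.aemeasurable).1 h2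

theorem integral_comp_X (h : IsSmallPerturbation P G δ D s t)
    {φ : (Fin p → ℝ) → ℝ} (hφ : Measurable φ) :
    ∫ w, φ (X w) ∂(perturbedLaw P G δ s t) = ∫ w, (1 + t * s w) * φ (X w) ∂P := by
  have hs := h.measurable_s
  rw [← integral_map measurable_X.aemeasurable hφ.aestronglyMeasurable, h.map_X_perturbedLaw,
    integral_map measurable_X.aemeasurable hφ.aestronglyMeasurable,
    integral_withDensity_ofReal (by fun_prop) (Eventually.of_forall h.one_add_nonneg)]

theorem integrable_moment (h : IsSmallPerturbation P G δ D s t)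
    [IsFiniteMeasure P] (hε : MemLp (fun w => Y w - G (X w)) 2 P) :
    Integrable (fun w => s w * (Y w - G (X w)) - δ (X w) - t * s w * δ (X w)) P := by
  have hs := h.measurable_s
  have hδ := h.measurable_δ.comp (measurable_X (p := p) (q := q))
  refine ((hε.integrable one_le_two).bdd_mul hs.aestronglyMeasurable
    (Eventually.of_forall h.abs_s_le)).sub ?_ |>.sub ?_
  · exact Integrable.of_bound hδ.aestronglyMeasurable D
      (Eventually.of_forall fun w => h.abs_δ_le (X w))
  · refine Integrable.of_bound (hs.const_mul t |>.mul hδ).aestronglyMeasurable (1 / 4 * D)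
      (Eventually.of_forall fun w => ?_)
    rw [Real.norm_eq_abs, abs_mul]
    exact mul_le_mul (h.abs_mul_le w) (h.abs_δ_le _) (abs_nonneg _) (by norm_num)

theorem measurable_error (h : IsSmallPerturbation P G δ D s t)
    : Measurable fun w : Obs p q => Y w - (G (X w) + t * δ (X w)) := by
  have hδm := h.measurable_δ
  have hX := measurable_X (p := p) (q := q)
  have hY := measurable_Y (p := p) (q := q)
  have hG := h.measurable_G
  fun_prop

theorem abs_kick_le (h : IsSmallPerturbation P G δ D s t) (w : Obs p q) :
    |resid P G δ s t w / |resid P G δ s t w| / t + t * δ (X w)| ≤ 1 / |t| + |t| * D := by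
  refine (abs_add_le _ _).trans ?_
  rw [abs_div, abs_div, abs_abs, abs_mul]
  gcongr
  · exact div_self_le_one _
  · exact h.abs_δ_le _

theorem integrable_error_sq_parts (h : IsSmallPerturbation P G δ D s t)
    [IsFiniteMeasure P] (hε : MemLp (fun w => Y w - G (X w)) 2 P) :
    Integrable (fun w => (1 + t * s w - kickWeight P G δ s t w) *
      (Y w - (G (X w) + t * δ (X w))) ^ 2) P ∧
    Integrable (fun w => kickWeight P G δ s t w *
      (Y (kickMap P G δ s t w) -
        (G (X (kickMap P G δ s t w)) + t * δ (X (kickMap P G δ s t w)))) ^ 2) P := by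
  have hδm := h.measurable_δ.comp (measurable_X (p := p) (q := q))
  have hδ : MemLp (fun w : Obs p q => t * δ (X w)) 2 P :=
    (MemLp.of_bound hδm.aestronglyMeasurable D
      (Eventually.of_forall fun w => h.abs_δ_le (X w))).const_mul t
  constructor
  · refine Integrable.bdd_mul (c := 2) ?_ h.measurable_density.aestronglyMeasurable ?_
    · refine ((hε.sub hδ).integrable_sq).congr (Eventually.of_forall fun w => ?_)
      simp only [Pi.sub_apply]; ring
    · filter_upwards [h.density_bounds] with w hw
      rw [Real.norm_eq_abs, abs_le]
      constructor <;> linarith [hw.1, hw.2]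
  · have hr := measurable_resid (P := P) (G := G) (δ := δ) (s := s) (t := t)
    refine Integrable.mul_bdd (c := (1 / |t| + |t| * D) ^ 2) integrable_kickWeight ?_ ?_
    · exact ((h.measurable_error.comp (measurable_kickMap h.measurable_G)).pow_const
        2).aestronglyMeasurable
    · refine Eventually.of_forall fun w => ?_
      rw [error_kickMap, Real.norm_eq_abs, abs_pow, abs_neg]
      exact pow_le_pow_left₀ (abs_nonneg _) (h.abs_kick_le w) 2

theorem integrable_error_sq (h : IsSmallPerturbation P G δ D s t)
    [IsFiniteMeasure P] (hε : MemLp (fun w => Y w - G (X w)) 2 P) :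
    Integrable (fun w => (Y w - (G (X w) + t * δ (X w))) ^ 2) (perturbedLaw P G δ s t) :=
  integrable_mixedLaw h.measurable_density h.density_nonneg measurable_kickWeight
    (Eventually.of_forall kickWeight_nonneg) (measurable_kickMap h.measurable_G)
    (h.measurable_error.pow_const 2) (h.integrable_error_sq_parts hε).1
    (h.integrable_error_sq_parts hε).2

theorem memLp_error (h : IsSmallPerturbation P G δ D s t)
    [IsFiniteMeasure P] (hε : MemLp (fun w => Y w - G (X w)) 2 P) :
    MemLp (fun w => Y w - (G (X w) + t * δ (X w))) 2 (perturbedLaw P G δ s t) :=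
  (memLp_two_iff_integrable_sq h.measurable_error.aestronglyMeasurable).2
    (h.integrable_error_sq hε)

/-- Mass `t² |resid|` at squared distance at most `t⁻²` costs at most `|resid|`, so the kicks do not
blow up the error variance. The constants come from the density bound `2` and from `(a + b)² ≤ 2 a²
+ 2 b²`, applied to both parts of the mixture. -/
theorem integral_error_sq_le (h : IsSmallPerturbation P G δ D s t)
    [IsProbabilityMeasure P] (hε : MemLp (fun w => Y w - G (X w)) 2 P) :
    ∫ w, (Y w - (G (X w) + t * δ (X w))) ^ 2 ∂(perturbedLaw P G δ s t) ≤
      4 * ∫ w, (Y w - G (X w)) ^ 2 ∂P + 2 * ∫ w, |resid P G δ s t w| ∂P + 6 * (t * D) ^ 2 := by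
  have i1 := (h.integrable_error_sq_parts hε).1
  have i2 := (h.integrable_error_sq_parts hε).2
  have i3 : Integrable (fun w => 4 * (Y w - G (X w)) ^ 2 + 2 * |resid P G δ s t w| +
      6 * (t * D) ^ 2) P :=
    ((hε.integrable_sq.const_mul 4).add (integrable_condExp.abs.const_mul 2)).add
      (integrable_const _)
  rw [perturbedLaw, integral_mixedLaw h.measurable_density h.density_nonneg
    measurable_kickWeight (Eventually.of_forall kickWeight_nonneg)
    (measurable_kickMap h.measurable_G) (h.measurable_error.pow_const 2) i1 i2,
    ← integral_add i1 i2]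
  have i4 : ∫ w, (4 * (Y w - G (X w)) ^ 2 + 2 * |resid P G δ s t w| + 6 * (t * D) ^ 2) ∂P =
      4 * ∫ w, (Y w - G (X w)) ^ 2 ∂P + 2 * ∫ w, |resid P G δ s t w| ∂P + 6 * (t * D) ^ 2 := by
    have j1 : Integrable (fun w => 4 * (Y w - G (X w)) ^ 2) P := hε.integrable_sq.const_mul 4
    have j2 : Integrable (fun w => 2 * |resid P G δ s t w|) P :=
      integrable_condExp.abs.const_mul 2
    rw [integral_add (f := fun w => 4 * (Y w - G (X w)) ^ 2 + 2 * |resid P G δ s t w|)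
      (j1.add j2) (integrable_const _), integral_add j1 j2, integral_const_mul, integral_const_mul]
    simp
  rw [← i4]
  refine integral_mono_ae (i1.add i2) i3 ?_
  filter_upwards [h.density_bounds, h.kickWeight_le] with w hw hk
  rw [error_kickMap, neg_sq]
  have hδ2 : (t * δ (X w)) ^ 2 ≤ (t * D) ^ 2 := by
    rw [mul_pow, mul_pow]
    refine mul_le_mul_of_nonneg_left ?_ (sq_nonneg _)
    rw [← sq_abs]
    exact pow_le_pow_left₀ (abs_nonneg _) (h.abs_δ_le _) 2
  have e1 : (1 + t * s w - kickWeight P G δ s t w) * (Y w - (G (X w) + t * δ (X w))) ^ 2 ≤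
      2 * (2 * (Y w - G (X w)) ^ 2 + 2 * (t * D) ^ 2) := by
    refine mul_le_mul hw.2 ?_ (sq_nonneg _) (by norm_num)
    nlinarith [sq_nonneg (Y w - G (X w) + t * δ (X w))]
  set κ := resid P G δ s t w / |resid P G δ s t w| / t
  have e2 : kickWeight P G δ s t w * κ ^ 2 ≤ |resid P G δ s t w| := by
    have ht := h.ne_zero
    have : kickWeight P G δ s t w * κ ^ 2 = |resid P G δ s t w| *
        (resid P G δ s t w / |resid P G δ s t w|) ^ 2 := by
      simp only [kickWeight, κ]
      field_simp
    rw [this]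
    refine mul_le_of_le_one_right (abs_nonneg _) ?_
    rw [← sq_abs, abs_div, abs_abs]
    exact pow_le_one₀ (by positivity) (div_self_le_one _)
  have e3 : kickWeight P G δ s t w * (κ + t * δ (X w)) ^ 2 ≤
      2 * |resid P G δ s t w| + 2 * (t * D) ^ 2 := by
    have h0 := kickWeight_nonneg (P := P) (G := G) (δ := δ) (s := s) (t := t) w
    calc kickWeight P G δ s t w * (κ + t * δ (X w)) ^ 2
        ≤ kickWeight P G δ s t w * (2 * κ ^ 2 + 2 * (t * D) ^ 2) := by
          refine mul_le_mul_of_nonneg_left ?_ h0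
          nlinarith [sq_nonneg (κ - t * δ (X w))]
      _ = 2 * (kickWeight P G δ s t w * κ ^ 2) + kickWeight P G δ s t w * (2 * (t * D) ^ 2) := by
          ring
      _ ≤ 2 * |resid P G δ s t w| + 1 * (2 * (t * D) ^ 2) := by
          gcongr
          linarith
      _ = _ := by ring
  linarith

/-- This is the exact conditional moment restriction, tested on events of `Z`. Reweighting produces
the conditional moment `t resid`, the kicks produce `-t resid`, and removing the moved mass from its
old place costs nothing since the kick weight depends on `Z` only and `ε` has conditional mean zero.
-/
theorem setIntegral_error_eq_zero (h : IsSmallPerturbation P G δ D s t) [IsProbabilityMeasure P]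
    (hε : MemLp (fun w => Y w - G (X w)) 2 P)
    (hε0 : P[fun w => Y w - G (X w) | sigmaZ p q] =ᵐ[P] 0) {A : Set (Obs p q)}
    (hA : MeasurableSet[sigmaZ p q] A) :
    ∫ w in A, (Y w - (G (X w) + t * δ (X w))) ∂(perturbedLaw P G δ s t) = 0 := by
  have hPt := h.isProbabilityMeasure
  have hAm : MeasurableSet A := sigmaZ_le _ hA
  obtain ⟨B, hB, rfl⟩ := hA
  -- The kick fixes `Z`, so it preserves every event of `Z`.
  have hmem : ∀ w, kickMap P G δ s t w ∈ Z ⁻¹' B ↔ w ∈ Z ⁻¹' B := fun w => Iff.rfl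
  set A := (Z : Obs p q → _) ⁻¹' B with hAdef
  have hAZ : MeasurableSet[sigmaZ p q] A := ⟨B, hB, rfl⟩
  have hεi : Integrable (fun w => Y w - G (X w)) P := hε.integrable one_le_two
  have hki := h.integrable_moment hε
  have hδm := h.measurable_δ.comp (measurable_X (p := p) (q := q))
  have hδ : Integrable (fun w : Obs p q => t * δ (X w)) P :=
    (Integrable.of_bound hδm.aestronglyMeasurable D
      (Eventually.of_forall fun w => h.abs_δ_le (X w))).const_mul t
  have i1 : Integrable (fun w => (1 + t * s w - kickWeight P G δ s t w) *
      (Y w - (G (X w) + t * δ (X w)))) P := by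
    refine Integrable.bdd_mul (c := 2) ?_ h.measurable_density.aestronglyMeasurable ?_
    · refine (hεi.sub hδ).congr (Eventually.of_forall fun w => ?_)
      simp only [Pi.sub_apply]; ring
    · filter_upwards [h.density_bounds] with w hw
      rw [Real.norm_eq_abs, abs_le]
      constructor <;> linarith [hw.1, hw.2]
  have i2 : Integrable (fun w => kickWeight P G δ s t w *
      (Y (kickMap P G δ s t w) -
        (G (X (kickMap P G δ s t w)) + t * δ (X (kickMap P G δ s t w))))) P := by
    refine Integrable.mul_bdd (c := 1 / |t| + |t| * D) integrable_kickWeight ?_ ?_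
    · exact (h.measurable_error.comp (measurable_kickMap h.measurable_G)).aestronglyMeasurable
    · refine Eventually.of_forall fun w => ?_
      rw [error_kickMap, Real.norm_eq_abs, abs_neg]
      exact h.abs_kick_le w
  have hind : ∀ (a f : Obs p q → ℝ), (fun w => a w * A.indicator f w) =
      A.indicator fun w => a w * f w := fun a f => by
    funext w
    by_cases hw : w ∈ A <;> simp [hw]
  have hind2 : ∀ f : Obs p q → ℝ, (fun w => A.indicator f (kickMap P G δ s t w)) =
      A.indicator fun w => f (kickMap P G δ s t w) := fun f => by
    funext w
    by_cases hw : w ∈ A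
    · rw [Set.indicator_of_mem hw, Set.indicator_of_mem ((hmem w).2 hw)]
    · rw [Set.indicator_of_notMem hw, Set.indicator_of_notMem (fun h' => hw ((hmem w).1 h'))]
  have hind3 : (fun w => kickWeight P G δ s t w * A.indicator
      (fun w => Y w - (G (X w) + t * δ (X w))) (kickMap P G δ s t w)) =
      A.indicator fun w => kickWeight P G δ s t w * (Y (kickMap P G δ s t w) -
        (G (X (kickMap P G δ s t w)) + t * δ (X (kickMap P G δ s t w)))) := by
    rw [← hind, ← hind2 fun w => Y w - (G (X w) + t * δ (X w))]
  rw [← integral_indicator hAm, perturbedLaw, integral_mixedLaw h.measurable_density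
    h.density_nonneg measurable_kickWeight (Eventually.of_forall kickWeight_nonneg)
    (measurable_kickMap h.measurable_G) (h.measurable_error.indicator hAm), hind, hind3,
    integral_indicator hAm, integral_indicator hAm, ← integral_add i1.integrableOn i2.integrableOn]
  rotate_left
  · rw [hind]; exact i1.indicator hAm
  · rw [hind3]; exact i2.indicator hAm
  have hwε : Integrable (fun w => kickWeight P G δ s t w * (Y w - G (X w))) P :=
    hεi.bdd_mul (c := 1 / 4) measurable_kickWeight.aestronglyMeasurable (by
      filter_upwards [h.kickWeight_le] with w hw
      rwa [Real.norm_eq_abs, abs_of_nonneg (kickWeight_nonneg w)])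
  have hri : Integrable (resid P G δ s t) P := integrable_condExp
  have z1 : ∫ w in A, (Y w - G (X w)) ∂P = 0 := by
    rw [← setIntegral_condExp sigmaZ_le hεi hAZ,
      setIntegral_congr_ae hAm (hε0.mono fun w hw _ => hw)]
    simp
  have z2 : ∫ w in A, kickWeight P G δ s t w * (Y w - G (X w)) ∂P = 0 := by
    have hsr : StronglyMeasurable[sigmaZ p q] (resid P G δ s t) := stronglyMeasurable_condExp
    have hsm : StronglyMeasurable[sigmaZ p q] (kickWeight P G δ s t) := hsr.norm.const_mul (t ^ 2)
    have := condExp_mul_of_stronglyMeasurable_left hsm hwε hεi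
    rw [← setIntegral_condExp sigmaZ_le hwε hAZ]
    have h0 : P[fun w => kickWeight P G δ s t w * (Y w - G (X w)) | sigmaZ p q] =ᵐ[P] 0 := by
      filter_upwards [this, hε0] with w h1 h2
      refine h1.trans ?_
      rw [Pi.mul_apply, h2]
      simp
    rw [setIntegral_congr_ae hAm (h0.mono fun w hw _ => hw)]
    simp
  have z3 : ∫ w in A, resid P G δ s t w ∂P = ∫ w in A,
      (s w * (Y w - G (X w)) - δ (X w) - t * s w * δ (X w)) ∂P :=
    setIntegral_condExp sigmaZ_le hki hAZ
  -- The terms `kickWeight * t * δ` from the two parts of the mixture cancel, as the kick lands at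
  -- distance `1/|t|` from `G(X)` whatever `δ` is.
  have key : ∀ w, (1 + t * s w - kickWeight P G δ s t w) * (Y w - (G (X w) + t * δ (X w))) +
      kickWeight P G δ s t w * (Y (kickMap P G δ s t w) -
        (G (X (kickMap P G δ s t w)) + t * δ (X (kickMap P G δ s t w)))) =
      (Y w - G (X w)) + t * (s w * (Y w - G (X w)) - δ (X w) - t * s w * δ (X w)) -
        kickWeight P G δ s t w * (Y w - G (X w)) - t * resid P G δ s t w := by
    intro w
    rw [error_kickMap]
    have hκ : kickWeight P G δ s t w * (resid P G δ s t w / |resid P G δ s t w| / t) =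
        t * resid P G δ s t w := by
      have ht := h.ne_zero
      -- Where `resid` vanishes the direction is `0 / 0 = 0` and the weight is zero as well.
      rcases eq_or_ne (resid P G δ s t w) 0 with h0 | h0
      · simp [h0]
      · have : |resid P G δ s t w| ≠ 0 := abs_ne_zero.2 h0
        simp only [kickWeight]
        field_simp
    linear_combination -hκ
  simp only [key]
  have j1 : Integrable (fun w => Y w - G (X w) +
      t * (s w * (Y w - G (X w)) - δ (X w) - t * s w * δ (X w))) (P.restrict A) :=
    (hεi.add (hki.const_mul t)).integrableOn
  have j2 : Integrable (fun w => Y w - G (X w) +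
      t * (s w * (Y w - G (X w)) - δ (X w) - t * s w * δ (X w)) -
        kickWeight P G δ s t w * (Y w - G (X w))) (P.restrict A) := j1.sub hwε.integrableOn
  rw [integral_sub j2 (hri.const_mul t).integrableOn, integral_sub j1 hwε.integrableOn,
    integral_add hεi.integrableOn (hki.const_mul t).integrableOn, integral_const_mul,
    integral_const_mul, z1, z2, z3]
  ring

theorem posDef_secondMoment (h : IsSmallPerturbation P G δ D s t) (hP : InModel P G) :
    (secondMoment (perturbedLaw P G δ s t)).PosDef := by
  have := hP.isProbabilityMeasure
  have hX : ∀ j, MemLp (fun w => X w j) 2 (perturbedLaw P G δ s t) := fun j =>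
    h.memLp_comp_X (measurable_pi_apply j) (hP.memLp_X j)
  refine Matrix.PosDef.of_dotProduct_mulVec_pos ?_ fun c hc => ?_
  · ext i j
    simp only [Matrix.conjTranspose_apply, secondMoment, Matrix.of_apply, star_trivial]
    exact integral_congr_ae (Eventually.of_forall fun w => mul_comm _ _)
  · have h1 := hP.posDef.dotProduct_mulVec_pos hc
    rw [star_trivial] at h1 ⊢
    rw [dotProduct_secondMoment_mulVec hP.memLp_X] at h1
    have hm : Measurable fun x : Fin p → ℝ => (c ⬝ᵥ x) ^ 2 := by
      unfold dotProduct
      fun_prop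
    rw [dotProduct_secondMoment_mulVec hX, h.integral_comp_X hm]
    have hi : Integrable (fun w => (c ⬝ᵥ X w) ^ 2) P := by
      by_contra hcon
      rw [integral_undef hcon] at h1
      exact lt_irrefl _ h1
    have hs := h.measurable_s
    have hi2 : Integrable (fun w => (1 + t * s w) * (c ⬝ᵥ X w) ^ 2) P := by
      refine hi.bdd_mul (c := 2) (by fun_prop) (Eventually.of_forall fun w => ?_)
      have := abs_le.1 (h.abs_mul_le w)
      rw [Real.norm_eq_abs, abs_le]
      constructor <;> linarith [this.1, this.2]
    calc 0 < 1 / 2 * ∫ w, (c ⬝ᵥ X w) ^ 2 ∂P := by positivity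
      _ = ∫ w, 1 / 2 * (c ⬝ᵥ X w) ^ 2 ∂P := (integral_const_mul _ _).symm
      _ ≤ _ := by
        refine integral_mono (hi.const_mul _) hi2 fun w => ?_
        have := abs_le.1 (h.abs_mul_le w)
        exact mul_le_mul_of_nonneg_right (by linarith [this.1]) (sq_nonneg _)

theorem inModel (h : IsSmallPerturbation P G δ D s t)
    (hP : InModel P G) (hε : MemLp (fun w => Y w - G (X w)) 2 P)
    (hε0 : P[fun w => Y w - G (X w) | sigmaZ p q] =ᵐ[P] 0) :
    InModel (perturbedLaw P G δ s t) (fun x => G x + t * δ x) := by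
  have := hP.isProbabilityMeasure
  have hprob := h.isProbabilityMeasure
  have hGm := h.measurable_G
  have hδm := h.measurable_δ
  have hgm : Measurable fun x => G x + t * δ x := by fun_prop
  have hG2 : MemLp (fun w => G (X w)) 2 P :=
    (memLp_map_measure_iff hGm.aestronglyMeasurable measurable_X.aemeasurable).1 hP.solves.memLp
  have hδ2 : MemLp (fun w : Obs p q => t * δ (X w)) 2 P :=
    (MemLp.of_bound (hδm.comp measurable_X).aestronglyMeasurable D
      (Eventually.of_forall fun w => h.abs_δ_le (X w))).const_mul t
  have hg : MemLp (fun w => G (X w) + t * δ (X w)) 2 (perturbedLaw P G δ s t) :=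
    h.memLp_comp_X hgm (hG2.add hδ2)
  have herr := (h.memLp_error hε).integrable one_le_two
  have hY : Integrable Y (perturbedLaw P G δ s t) :=
    (herr.add (hg.integrable one_le_two)).congr (Eventually.of_forall fun w => by simp)
  have hce : (perturbedLaw P G δ s t)[Y | sigmaZ p q] =ᵐ[perturbedLaw P G δ s t]
      (perturbedLaw P G δ s t)[fun w => G (X w) + t * δ (X w) | sigmaZ p q] := by
    -- Zero is a version of the conditional mean of the new error, which gives `E[Y | Z] = E[g_t(X)
    -- | Z]` after splitting the difference.
    have h0 : (0 : Obs p q → ℝ) =ᵐ[perturbedLaw P G δ s t]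
        (perturbedLaw P G δ s t)[fun w => Y w - (G (X w) + t * δ (X w)) | sigmaZ p q] :=
      ae_eq_condExp_of_forall_setIntegral_eq sigmaZ_le herr
        (fun _ _ _ => (integrable_zero _ _ _).integrableOn)
        (fun A hA _ => by rw [h.setIntegral_error_eq_zero hε hε0 hA]; simp)
        aestronglyMeasurable_zero
    have h1 := condExp_sub hY (hg.integrable one_le_two) (sigmaZ p q)
    filter_upwards [h0, h1] with w h2 h3
    have h4 := h2.trans h3
    rw [Pi.zero_apply, Pi.sub_apply] at h4
    linarith
  exact
    { isProbabilityMeasure := hprob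
      integrable_Y := hY
      solves :=
        { memLp := (memLp_map_measure_iff hgm.aestronglyMeasurable measurable_X.aemeasurable).2 hg
          condExp_eq := hce }
      memLp_r := (memLp_congr_ae hce).2 (hg.condExp one_le_two)
      memLp_X := fun j => h.memLp_comp_X (measurable_pi_apply j) (hP.memLp_X j)
      posDef := h.posDef_secondMoment hP }

end IsSmallPerturbation

end OLIVA

/-! ### Score families: the correction is negligible as `t → 0` -/

namespace OLIVA

variable {p q : ℕ} {P : Measure (Obs p q)} {G δ : (Fin p → ℝ) → ℝ} {D : ℝ}

theorem integral_abs_mul_le_sqrt_mul_sqrt {Ω : Type*} [MeasurableSpace Ω] {μ : Measure Ω}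
    {f g : Ω → ℝ} (hf : MemLp f 2 μ) (hg : MemLp g 2 μ) :
    ∫ w, |f w * g w| ∂μ ≤ √(∫ w, f w ^ 2 ∂μ) * √(∫ w, g w ^ 2 ∂μ) := by
  have h := integral_mul_norm_le_Lp_mul_Lq (μ := μ) (f := f) (g := g) Real.HolderConjugate.two_two
    (by simpa using hf) (by simpa using hg)
  simpa [abs_mul, Real.sqrt_eq_rpow] using h

theorem tendsto_matrix_inv {α n : Type*} [Fintype n] [DecidableEq n] {l : Filter α}
    {A : α → Matrix n n ℝ} {B : Matrix n n ℝ} (h : Tendsto A l (𝓝 B)) (hB : B.det ≠ 0) :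
    Tendsto (fun t => (A t)⁻¹) l (𝓝 B⁻¹) := by
  simp only [Matrix.inv_def, Ring.inverse_eq_inv']
  have h1 : Tendsto (fun t => (A t).det) l (𝓝 B.det) :=
    ((continuous_id.matrix_det (n := n) (R := ℝ)).tendsto B).comp h
  have h2 : Tendsto (fun t => (A t).adjugate) l (𝓝 B.adjugate) :=
    ((continuous_id.matrix_adjugate (n := n) (R := ℝ)).tendsto B).comp h
  exact (h1.inv₀ hB).smul h2

/-- If `ε²` were not integrable, its conditional expectation would be `0` by convention,
contradicting the positive lower bound. -/
theorem memLp_error_of_boundedCondVariance [IsProbabilityMeasure P] (hG : Measurable G)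
    (hvar : BoundedCondVariance P G) : MemLp (fun w => Y w - G (X w)) 2 P := by
  have hm : Measurable fun w : Obs p q => Y w - G (X w) :=
    measurable_Y.sub (hG.comp measurable_X)
  rw [memLp_two_iff_integrable_sq hm.aestronglyMeasurable]
  by_contra hcon
  obtain ⟨c, C, hc, h⟩ := hvar
  rw [condExp_of_not_integrable hcon] at h
  obtain ⟨w, hw⟩ := h.exists
  exact absurd hw.1 (not_le.2 hc)

theorem InModel.memLp_comp_X (hP : InModel P G) (hG : Measurable G) :
    MemLp (fun w => G (X w)) 2 P :=
  (memLp_map_measure_iff hG.aestronglyMeasurable measurable_X.aemeasurable).1 hP.solves.memLp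

theorem InModel.condExp_error (hP : InModel P G) (hG : Measurable G) :
    P[fun w => Y w - G (X w) | sigmaZ p q] =ᵐ[P] 0 := by
  have := hP.isProbabilityMeasure
  filter_upwards [condExp_sub hP.integrable_Y ((hP.memLp_comp_X hG).integrable one_le_two)
    (sigmaZ p q), hP.solves.condExp_eq] with w h1 h2
  refine h1.trans ?_
  rw [Pi.sub_apply, h2, sub_self, Pi.zero_apply]

/-- From `|s ε| ≤ M (1 + ε²) / 2`, conditioning on `Z` brings in only the conditional variance,
which is at most `C`. This is the use of the upper bound on `Ω`: it keeps the kick weight uniformly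
small. -/
theorem abs_resid_le [IsProbabilityMeasure P]
    (hε : MemLp (fun w => Y w - G (X w)) 2 P) {C : ℝ}
    (hC : ∀ᵐ w ∂P, (P[fun w => (Y w - G (X w)) ^ 2 | sigmaZ p q]) w ≤ C)
    (hδm : Measurable δ) (hD : ∀ x, |δ x| ≤ D)
    {s : Obs p q → ℝ} (hs : Measurable s) {M : ℝ} (hM : 0 ≤ M) (hsM : ∀ w, |s w| ≤ M) (t : ℝ) :
    ∀ᵐ w ∂P, |resid P G δ s t w| ≤ M * (1 + C) / 2 + D + |t| * M * D := by
  have hD0 : 0 ≤ D := (abs_nonneg _).trans (hD 0)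
  have hδc : Measurable fun w : Obs p q => δ (X w) := hδm.comp measurable_X
  set k : Obs p q → ℝ := fun w => s w * (Y w - G (X w)) - δ (X w) - t * s w * δ (X w) with hk
  set B : Obs p q → ℝ := fun w => (M / 2 + D + |t| * M * D) + M / 2 * (Y w - G (X w)) ^ 2 with hB
  have hki : Integrable k P := by
    refine (((hε.integrable one_le_two).bdd_mul hs.aestronglyMeasurable
      (Eventually.of_forall hsM)).sub ?_).sub ?_
    · exact Integrable.of_bound hδc.aestronglyMeasurable D (Eventually.of_forall fun w => hD _)
    · refine Integrable.of_bound ((hs.const_mul t).mul hδc).aestronglyMeasurable (|t| * M * D)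
        (Eventually.of_forall fun w => ?_)
      rw [Real.norm_eq_abs, abs_mul, abs_mul]
      have := hsM w
      have := hD (X w)
      gcongr
  have hsq : Integrable (fun w => M / 2 * (Y w - G (X w)) ^ 2) P := hε.integrable_sq.const_mul _
  have hBi : Integrable B P := (integrable_const _).add hsq
  have hkB : ∀ w, |k w| ≤ B w := by
    intro w
    have h1 : |s w * (Y w - G (X w))| ≤ M * ((1 + (Y w - G (X w)) ^ 2) / 2) := by
      rw [abs_mul]
      refine mul_le_mul (hsM w) ?_ (abs_nonneg _) hM
      nlinarith [sq_nonneg (|Y w - G (X w)| - 1), sq_abs (Y w - G (X w))]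
    have h2 : |t * s w * δ (X w)| ≤ |t| * M * D := by
      rw [abs_mul, abs_mul]
      have := hsM w
      have := hD (X w)
      gcongr
    calc |k w| ≤ |s w * (Y w - G (X w)) - δ (X w)| + |t * s w * δ (X w)| := abs_sub _ _
      _ ≤ |s w * (Y w - G (X w))| + |δ (X w)| + |t * s w * δ (X w)| := by gcongr; exact abs_sub _ _
      _ ≤ M * ((1 + (Y w - G (X w)) ^ 2) / 2) + D + |t| * M * D := by
        have := hD (X w)
        gcongr
      _ = B w := by simp only [hB]; ring
  have e1 : P[k | sigmaZ p q] ≤ᵐ[P] P[B | sigmaZ p q] :=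
    condExp_mono hki hBi (Eventually.of_forall fun w => (abs_le.1 (hkB w)).2)
  have e2 : P[-B | sigmaZ p q] ≤ᵐ[P] P[k | sigmaZ p q] :=
    condExp_mono hBi.neg hki (Eventually.of_forall fun w => (abs_le.1 (hkB w)).1)
  have e3 := condExp_neg (μ := P) B (sigmaZ p q)
  have e4 : P[B | sigmaZ p q] =ᵐ[P] P[fun _ => M / 2 + D + |t| * M * D | sigmaZ p q] +
      P[fun w => M / 2 * (Y w - G (X w)) ^ 2 | sigmaZ p q] :=
    condExp_add (integrable_const _) hsq _
  have e5 : P[fun w => M / 2 * (Y w - G (X w)) ^ 2 | sigmaZ p q] =ᵐ[P]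
      (M / 2) • P[fun w => (Y w - G (X w)) ^ 2 | sigmaZ p q] := 
    condExp_smul (M / 2) (fun w => (Y w - G (X w)) ^ 2) (sigmaZ p q)
  filter_upwards [e1, e2, e3, e4, e5, hC] with w h1 h2 h3 h4 h5 h6
  rw [Pi.add_apply, h5, condExp_const sigmaZ_le, Pi.smul_apply, smul_eq_mul] at h4
  have h7 : (P[B | sigmaZ p q]) w ≤ M * (1 + C) / 2 + D + |t| * M * D := by
    rw [h4]
    have : M / 2 * (P[fun w => (Y w - G (X w)) ^ 2 | sigmaZ p q]) w ≤ M / 2 * C := by gcongr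
    linarith
  rw [h3, Pi.neg_apply] at h2
  rw [resid, abs_le]
  constructor
  · linarith
  · linarith

/-- A family of bounded mean-zero functions `σ t` that converges to the score `s` at a moderate
rate of growth, where `s` is compatible with the direction `δ` of the structural function. -/
structure IsScoreFamily (P : Measure (Obs p q)) (G δ : (Fin p → ℝ) → ℝ) (D : ℝ) (s : Obs p q → ℝ)
    (σ : ℝ → Obs p q → ℝ) (v : Fin p → ℝ) : Prop where
  measurable_G : Measurable G
  inModel_P : InModel P G
  boundedCondVariance : BoundedCondVariance P G
  measurable_δ : Measurable δ
  abs_δ_le : ∀ x, |δ x| ≤ D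
  memLp_s : MemLp s 2 P
  condExp_s : P[fun w => s w * (Y w - G (X w)) | sigmaZ p q] =ᵐ[P] P[fun w => δ (X w) | sigmaZ p q]
  measurable_σ : ∀ t, Measurable (σ t)
  -- A uniform null bound keeps the density near `1`; it also makes the kick weight, of order `t² |σ
  -- t|`, tend to zero uniformly.
  abs_mul_le : ∀ᶠ t in 𝓝[≠] (0 : ℝ), ∀ w, |t * σ t w| ≤ √|t|
  integral_σ : ∀ t, ∫ w, σ t w ∂P = 0
  tendsto_σ : Tendsto (fun t => ∫ w, (σ t w - s w) ^ 2 ∂P) (𝓝[≠] 0) (𝓝 0)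
  -- Convergence is required separately, since the weight multiplying `σ t` is only integrable and
  -- `L₂` convergence of `σ t` does not control the integral.
  tendsto_v : ∀ j, Tendsto
    (fun t => ∫ w, X w j * (G (X w) - X w ⬝ᵥ beta P G) * σ t w ∂P) (𝓝[≠] 0) (𝓝 (v j))

/-- A null sequence that bounds the share of moved mass. -/
def kickBound (C D t : ℝ) : ℝ := |t| * √|t| * (1 + C) / 2 + t ^ 2 * D + t ^ 2 * √|t| * D

theorem tendsto_kickBound (C D : ℝ) : Tendsto (kickBound C D) (𝓝[≠] 0) (𝓝 0) := by
  have : Continuous (kickBound C D) := by unfold kickBound; fun_prop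
  have h := this.tendsto 0
  simp only [kickBound, abs_zero, Real.sqrt_zero] at h
  norm_num at h
  exact h.mono_left nhdsWithin_le_nhds

theorem tendsto_sqrt_abs : Tendsto (fun t : ℝ => √|t|) (𝓝[≠] 0) (𝓝 0) := by
  have : Continuous fun t : ℝ => √|t| := by fun_prop
  have h := this.tendsto 0
  simp only [abs_zero, Real.sqrt_zero] at h
  exact h.mono_left nhdsWithin_le_nhds

namespace IsScoreFamily

variable {s : Obs p q → ℝ} {σ : ℝ → Obs p q → ℝ} {v : Fin p → ℝ}

theorem memLp_error (h : IsScoreFamily P G δ D s σ v) : MemLp (fun w => Y w - G (X w)) 2 P :=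
  have := h.inModel_P.isProbabilityMeasure
  memLp_error_of_boundedCondVariance h.measurable_G h.boundedCondVariance

theorem exists_kickWeight_le (h : IsScoreFamily P G δ D s σ v) : ∃ C, ∀ᶠ t in 𝓝[≠] (0 : ℝ),
    ∀ᵐ w ∂P, kickWeight P G δ (σ t) t w ≤ kickBound C D t := by
  have := h.inModel_P.isProbabilityMeasure
  obtain ⟨c, C, hc, hvar⟩ := h.boundedCondVariance
  refine ⟨C, ?_⟩
  filter_upwards [h.abs_mul_le, self_mem_nhdsWithin] with t ht ht0
  have ht0' : 0 < |t| := abs_pos.2 ht0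
  -- With this bound as `M` in `abs_resid_le`, multiplying by `t²` gives exactly `kickBound`.
  have hM : ∀ w, |σ t w| ≤ √|t| / |t| := fun w => by
    rw [le_div_iff₀ ht0', mul_comm, ← abs_mul]
    exact ht w
  filter_upwards [abs_resid_le h.memLp_error (hvar.mono fun w hw => hw.2)
    h.measurable_δ h.abs_δ_le (h.measurable_σ t) (by positivity) hM t] with w hw
  calc kickWeight P G δ (σ t) t w ≤
        t ^ 2 * (√|t| / |t| * (1 + C) / 2 + D + |t| * (√|t| / |t|) * D) := by
          unfold kickWeight; gcongr
    _ = kickBound C D t := by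
      unfold kickBound
      rw [← sq_abs t]
      field_simp

theorem eventually_isSmallPerturbation (h : IsScoreFamily P G δ D s σ v) :
    ∀ᶠ t in 𝓝[≠] (0 : ℝ), IsSmallPerturbation P G δ D (σ t) t := by
  obtain ⟨C, hC⟩ := h.exists_kickWeight_le
  filter_upwards [h.abs_mul_le, self_mem_nhdsWithin, hC,
    (tendsto_kickBound C D).eventually_le_const (show (0 : ℝ) < 1 / 4 by norm_num),
    tendsto_sqrt_abs.eventually_le_const (show (0 : ℝ) < 1 / 4 by norm_num)] with t h1 h2 h3 h4 h5
  exact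
    { measurable_G := h.measurable_G
      measurable_δ := h.measurable_δ
      abs_δ_le := h.abs_δ_le
      measurable_s := h.measurable_σ t
      abs_mul_le := fun w => (h1 w).trans h5
      integral_s := h.integral_σ t
      ne_zero := h2
      kickWeight_le := h3.mono fun w hw => hw.trans h4 }

theorem memLp_σ (h : IsScoreFamily P G δ D s σ v)
    {t : ℝ} (ht : IsSmallPerturbation P G δ D (σ t) t) : MemLp (σ t) 2 P :=
  have := h.inModel_P.isProbabilityMeasure
  MemLp.of_bound ht.measurable_s.aestronglyMeasurable _ (Eventually.of_forall ht.abs_s_le)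

/-- Compatibility of `s` with `δ` says that the limiting residual is zero. Subtracting it leaves the
conditional mean of `(σ_t - s) ε - t σ_t δ`; conditional expectation contracts `L₁`, and
Cauchy–Schwarz handles the first term. -/
theorem tendsto_integral_abs_resid (h : IsScoreFamily P G δ D s σ v) :
    Tendsto (fun t => ∫ w, |resid P G δ (σ t) t w| ∂P) (𝓝[≠] 0) (𝓝 0) := by
  have := h.inModel_P.isProbabilityMeasure
  have hε := h.memLp_error
  have hδc : Measurable fun w : Obs p q => δ (X w) := h.measurable_δ.comp measurable_X
  have hδi : Integrable (fun w : Obs p q => δ (X w)) P :=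
    Integrable.of_bound hδc.aestronglyMeasurable D (Eventually.of_forall fun w => h.abs_δ_le _)
  have hlim : Tendsto (fun t => √(∫ w, (σ t w - s w) ^ 2 ∂P) * √(∫ w, (Y w - G (X w)) ^ 2 ∂P) +
      √|t| * D) (𝓝[≠] 0) (𝓝 0) := by
    have := (h.tendsto_σ.sqrt.mul_const (√(∫ w, (Y w - G (X w)) ^ 2 ∂P))).add
      (tendsto_sqrt_abs.mul_const D)
    simpa using this
  refine squeeze_zero' (Eventually.of_forall fun t => integral_nonneg fun w => abs_nonneg _) ?_ hlim
  filter_upwards [h.eventually_isSmallPerturbation, h.abs_mul_le] with t ht htb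
  have hd : MemLp (fun w => σ t w - s w) 2 P := (h.memLp_σ ht).sub h.memLp_s
  have hk := ht.integrable_moment hε
  have hsε : Integrable (fun w => s w * (Y w - G (X w))) P := h.memLp_s.integrable_mul hε
  have hdε : Integrable (fun w => (σ t w - s w) * (Y w - G (X w))) P := hd.integrable_mul hε
  have htδ : ∀ w : Obs p q, |t * σ t w * δ (X w)| ≤ √|t| * D := fun w => by
    rw [abs_mul]
    exact mul_le_mul (htb w) (h.abs_δ_le _) (abs_nonneg _) (Real.sqrt_nonneg _)
  have hσδ : Integrable (fun w => t * σ t w * δ (X w)) P :=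
    Integrable.of_bound (((h.measurable_σ t).const_mul t).mul hδc).aestronglyMeasurable _
      (Eventually.of_forall htδ)
  have e1 := condExp_sub hk (hsε.sub hδi) (sigmaZ p q)
  have e2 := condExp_sub hsε hδi (sigmaZ p q)
  have e3 : resid P G δ (σ t) t =ᵐ[P]
      P[fun w => (σ t w - s w) * (Y w - G (X w)) - t * σ t w * δ (X w) | sigmaZ p q] := by
    have e4 : (fun w => (σ t w - s w) * (Y w - G (X w)) - t * σ t w * δ (X w)) =
        (fun w => σ t w * (Y w - G (X w)) - δ (X w) - t * σ t w * δ (X w)) -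
          ((fun w => s w * (Y w - G (X w))) - fun w => δ (X w)) := by
      funext w
      simp only [Pi.sub_apply]
      ring
    rw [e4]
    filter_upwards [e1, e2, h.condExp_s] with w h1 h2 h3
    rw [h1, Pi.sub_apply, h2, Pi.sub_apply, h3, sub_self, sub_zero, resid]
  calc ∫ w, |resid P G δ (σ t) t w| ∂P
      = ∫ w, |(P[fun w => (σ t w - s w) * (Y w - G (X w)) - t * σ t w * δ (X w) | sigmaZ p q]) w|
          ∂P := integral_congr_ae (e3.mono fun w hw => by simp only [hw])
    _ ≤ ∫ w, |(σ t w - s w) * (Y w - G (X w)) - t * σ t w * δ (X w)| ∂P :=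
        integral_abs_condExp_le _
    _ ≤ ∫ w, (|(σ t w - s w) * (Y w - G (X w))| + √|t| * D) ∂P := by
        refine integral_mono (hdε.sub hσδ).abs (hdε.abs.add (integrable_const _)) fun w => ?_
        exact (abs_sub _ _).trans (by gcongr; exact htδ w)
    _ = ∫ w, |(σ t w - s w) * (Y w - G (X w))| ∂P + √|t| * D := by
        rw [integral_add hdε.abs (integrable_const _)]
        simp
    _ ≤ _ := by
        gcongr
        exact integral_abs_mul_le_sqrt_mul_sqrt hd hε

theorem exists_eLpNorm_error_le (h : IsScoreFamily P G δ D s σ v) : ∃ C : ℝ≥0, ∀ᶠ t in 𝓝[≠] (0 : ℝ),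
    eLpNorm (fun w => Y w - (G (X w) + t * δ (X w))) 2 (perturbedLaw P G δ (σ t) t) ≤ C := by
  have := h.inModel_P.isProbabilityMeasure
  -- The bound of `integral_error_sq_le` once `∫ |resid| ≤ 1` and `|t| ≤ 1`.
  set K : ℝ := 4 * ∫ w, (Y w - G (X w)) ^ 2 ∂P + 2 * 1 + 6 * D ^ 2 with hK
  have hK0 : 0 ≤ K := by
    have : 0 ≤ ∫ w, (Y w - G (X w)) ^ 2 ∂P := integral_nonneg fun w => sq_nonneg _
    positivity
  refine ⟨(√K).toNNReal, ?_⟩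
  filter_upwards [h.eventually_isSmallPerturbation,
    h.tendsto_integral_abs_resid.eventually_le_const (show (0 : ℝ) < 1 by norm_num),
    tendsto_sqrt_abs.eventually_le_const (show (0 : ℝ) < 1 by norm_num)] with t ht h1 h2
  have hD := ht.D_nonneg
  rw [(ht.memLp_error h.memLp_error).eLpNorm_eq_integral_rpow_norm (by simp) (by simp)]
  refine ENNReal.ofReal_le_ofReal ?_
  rw [Real.sqrt_eq_rpow]
  simp only [ENNReal.toReal_ofNat, Real.norm_eq_abs, Real.rpow_ofNat, sq_abs, one_div]
  refine Real.rpow_le_rpow (integral_nonneg fun w => sq_nonneg _) ?_ (by norm_num)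
  refine (ht.integral_error_sq_le h.memLp_error).trans ?_
  have h3 : (t * D) ^ 2 ≤ D ^ 2 := by
    have : |t| ≤ 1 := by
      rw [Real.sqrt_le_one] at h2
      exact h2
    rw [mul_pow, ← sq_abs t]
    exact mul_le_of_le_one_left (sq_nonneg _) (pow_le_one₀ (abs_nonneg _) this)
  rw [hK]
  gcongr

end IsScoreFamily

end OLIVA

/-! ### Differentiability in quadratic mean and the derivative of `β` -/

namespace OLIVA

variable {p q : ℕ} {P : Measure (Obs p q)} {G δ : (Fin p → ℝ) → ℝ} {D : ℝ}

/-- The squared remainder of `√(1 + x - r)` against its linearisation `1 + y / 2`. -/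
theorem sq_sqrt_sub_le {x y r κ : ℝ} (hx : |x| ≤ κ) (hr0 : 0 ≤ r) (hr : r ≤ κ) (hκ : κ ≤ 1 / 4) :
    (√(1 + x - r) - 1 - y / 2) ^ 2 ≤
      12 * κ ^ 2 * ((x - y) ^ 2 + y ^ 2) + 2 * (x - y) ^ 2 + 4 * r := by
  have hx' := abs_le.1 hx
  have h1 := abs_sqrt_one_add_sub_le (y := x - r) (by linarith [hx'.1])
  rw [← add_sub_assoc] at h1
  set z := √(1 + x - r) - 1 - (x - r) / 2 with hz
  have hκ0 : 0 ≤ κ := hr0.trans hr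
  have h2 : |x - r| ≤ 2 * κ := (abs_sub _ _).trans (by rw [abs_of_nonneg hr0]; linarith)
  have h3 : (x - r) ^ 2 ≤ 4 * κ ^ 2 := by
    rw [← sq_abs]
    calc |x - r| ^ 2 ≤ (2 * κ) ^ 2 := pow_le_pow_left₀ (abs_nonneg _) h2 2
      _ = 4 * κ ^ 2 := by ring
  have h4 : z ^ 2 ≤ κ ^ 2 * (x - r) ^ 2 := by
    rw [← sq_abs]
    calc |z| ^ 2 ≤ ((x - r) ^ 2 / 2) ^ 2 := pow_le_pow_left₀ (abs_nonneg _) h1 2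
      _ = (x - r) ^ 2 * (x - r) ^ 2 / 4 := by ring
      _ ≤ 4 * κ ^ 2 * (x - r) ^ 2 / 4 := by gcongr
      _ = κ ^ 2 * (x - r) ^ 2 := by ring
  have h5 : r ^ 2 ≤ r / 4 := by nlinarith
  have h6 : (x - r) ^ 2 ≤ 2 * x ^ 2 + 2 * r ^ 2 := by nlinarith [sq_nonneg (x + r)]
  have h7 : x ^ 2 ≤ 2 * (x - y) ^ 2 + 2 * y ^ 2 := by nlinarith [sq_nonneg (x - 2 * y)]
  have h8 : κ ^ 2 ≤ 1 := pow_le_one₀ hκ0 (by linarith)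
  have h9 : (x - r) ^ 2 ≤ 4 * ((x - y) ^ 2 + y ^ 2) + r / 2 := by linarith
  have h10 : z ^ 2 ≤ 4 * (κ ^ 2 * ((x - y) ^ 2 + y ^ 2)) + r / 2 := by
    calc z ^ 2 ≤ κ ^ 2 * (4 * ((x - y) ^ 2 + y ^ 2) + r / 2) :=
          h4.trans (mul_le_mul_of_nonneg_left h9 (sq_nonneg _))
      _ = 4 * (κ ^ 2 * ((x - y) ^ 2 + y ^ 2)) + κ ^ 2 * (r / 2) := by ring
      _ ≤ _ := by
        gcongr
        exact mul_le_of_le_one_left (by linarith) h8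
  have h11 : √(1 + x - r) - 1 - y / 2 = z + (x - y) / 2 - r / 2 := by rw [hz]; ring
  rw [h11]
  -- The factor `12` is this `3` times the `4` of `h10`; the remaining terms in `r` stay below `4 r`
  -- because `r ≤ 1 / 4`.
  have h12 : (z + (x - y) / 2 - r / 2) ^ 2 ≤ 3 * (z ^ 2 + ((x - y) / 2) ^ 2 + (r / 2) ^ 2) := by
    nlinarith [sq_nonneg (z - (x - y) / 2), sq_nonneg (z + r / 2), sq_nonneg ((x - y) / 2 + r / 2)]
  nlinarith [sq_nonneg (x - y)]

theorem secondMoment_mulVec_beta {Q : Measure (Obs p q)} {g : (Fin p → ℝ) → ℝ}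
    (hQ : (secondMoment Q).PosDef) :
    secondMoment Q *ᵥ beta Q g = fun j => ∫ w, X w j * g (X w) ∂Q := by
  have : IsUnit (secondMoment Q).det := (Matrix.isUnit_iff_isUnit_det _).1 hQ.isUnit
  rw [beta, Matrix.mulVec_mulVec, Matrix.mul_nonsing_inv _ this, Matrix.one_mulVec]

theorem secondMoment_mulVec_apply {Q : Measure (Obs p q)}
    (hX : ∀ j, MemLp (fun w => X w j) 2 Q) (c : Fin p → ℝ) (j : Fin p) :
    (secondMoment Q *ᵥ c) j = ∫ w, X w j * (X w ⬝ᵥ c) ∂Q := by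
  simp only [Matrix.mulVec, dotProduct, secondMoment, Matrix.of_apply, Finset.mul_sum]
  rw [integral_finsetSum _ fun k _ => by
    simpa only [mul_assoc, Pi.mul_apply] using ((hX j).integrable_mul (hX k)).mul_const (c k)]
  refine Finset.sum_congr rfl fun k _ => ?_
  rw [← integral_mul_const]
  simp only [mul_assoc]

namespace IsScoreFamily

variable {s : Obs p q → ℝ} {σ : ℝ → Obs p q → ℝ} {v : Fin p → ℝ}

/-- After division by `t²`, the moved mass contributes `∫ |resid|` and the reweighted part
contributes `‖σ_t - s‖₂²`, again `∫ |resid|`, and a null factor times `‖σ_t - s‖₂² + ‖s‖₂²`. All of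
these tend to zero. -/
theorem isQMD (h : IsScoreFamily P G δ D s σ v) (law : ℝ → Measure (Obs p q))
    (hlaw : ∀ t, t ≠ 0 → law t = perturbedLaw P G δ (σ t) t) : IsQMD P law s := by
  have := h.inModel_P.isProbabilityMeasure
  refine ⟨h.memLp_s, ?_⟩
  obtain ⟨C, hC⟩ := h.exists_kickWeight_le
  -- A common null bound for `|t σ_t|` and the kick weight, as `sq_sqrt_sub_le` requires.
  set κ : ℝ → ℝ := fun t => max (√|t|) (kickBound C D t) with hκ
  have hκlim : Tendsto κ (𝓝[≠] 0) (𝓝 0) := by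
    simpa using tendsto_sqrt_abs.max (tendsto_kickBound C D)
  set I : ℝ → ℝ := fun t => ∫ w, (σ t w - s w) ^ 2 ∂P with hI
  set R : ℝ → ℝ := fun t => ∫ w, |resid P G δ (σ t) t w| ∂P with hR
  set S : ℝ := ∫ w, s w ^ 2 ∂P with hS
  have hIlim : Tendsto I (𝓝[≠] 0) (𝓝 0) := h.tendsto_σ
  have hRlim : Tendsto R (𝓝[≠] 0) (𝓝 0) := h.tendsto_integral_abs_resid
  have hlim : Tendsto (fun t => 2 * R t + 2 * (12 * κ t ^ 2 * (I t + S) + 2 * I t + 4 * R t))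
      (𝓝[≠] 0) (𝓝 0) := by
    have h1 := (((hκlim.pow 2).const_mul 12).mul (hIlim.add_const S)).add (hIlim.const_mul 2)
    have h2 := (hRlim.const_mul 2).add ((h1.add (hRlim.const_mul 4)).const_mul 2)
    simpa using h2
  refine squeeze_zero' (Eventually.of_forall fun t => by positivity) ?_ hlim
  filter_upwards [h.eventually_isSmallPerturbation, h.abs_mul_le, hC, self_mem_nhdsWithin,
    hκlim.eventually_le_const (show (0 : ℝ) < 1 / 4 by norm_num)] with t ht htb htC ht0 hκt
  have ht0' : 0 < t ^ 2 := by
    have : t ≠ 0 := ht0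
    positivity
  rw [hlaw t ht0, div_le_iff₀ ht0']
  have hd : MemLp (fun w => σ t w - s w) 2 P := (h.memLp_σ ht).sub h.memLp_s
  have hptw : ∀ᵐ w ∂P, (√(1 + t * σ t w - kickWeight P G δ (σ t) t w) - 1 - t / 2 * s w) ^ 2 ≤
      t ^ 2 * (12 * κ t ^ 2 * ((σ t w - s w) ^ 2 + s w ^ 2) + 2 * (σ t w - s w) ^ 2 +
        4 * |resid P G δ (σ t) t w|) := by
    filter_upwards [htC] with w hw
    have := sq_sqrt_sub_le (y := t * s w) ((htb w).trans (le_max_left _ _))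
      (kickWeight_nonneg w) (hw.trans (le_max_right _ _)) hκt
    calc _ = (√(1 + t * σ t w - kickWeight P G δ (σ t) t w) - 1 - t * s w / 2) ^ 2 := by ring
      _ ≤ _ := this
      _ = _ := by unfold kickWeight; ring
  have hsq : Integrable (fun w => s w ^ 2) P := h.memLp_s.integrable_sq
  have hdq : Integrable (fun w => (σ t w - s w) ^ 2) P := hd.integrable_sq
  have hrq : Integrable (fun w => |resid P G δ (σ t) t w|) P := integrable_condExp.abs
  have i1 : Integrable (fun w => 12 * κ t ^ 2 * ((σ t w - s w) ^ 2 + s w ^ 2)) P :=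
    (hdq.add hsq).const_mul _
  have i2 : Integrable (fun w => 12 * κ t ^ 2 * ((σ t w - s w) ^ 2 + s w ^ 2) +
      2 * (σ t w - s w) ^ 2) P := i1.add (hdq.const_mul 2)
  have i3 : Integrable (fun w => 12 * κ t ^ 2 * ((σ t w - s w) ^ 2 + s w ^ 2) +
      2 * (σ t w - s w) ^ 2 + 4 * |resid P G δ (σ t) t w|) P := i2.add (hrq.const_mul 4)
  have i4 : Integrable
      (fun w => (√(1 + t * σ t w - kickWeight P G δ (σ t) t w) - 1 - t / 2 * s w) ^ 2) P := by
    refine (i3.const_mul (t ^ 2)).mono' ?_ ?_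
    · have h1 := ht.measurable_density.sqrt.sub_const 1
      exact (h1.aestronglyMeasurable.sub
        (h.memLp_s.aestronglyMeasurable.const_mul (t / 2))).pow 2
    · filter_upwards [hptw] with w hw
      rwa [Real.norm_eq_abs, abs_of_nonneg (sq_nonneg _)]
  refine (integral_sqrt_rnDeriv_mixedLaw_le ht.measurable_density ht.integrable_density
    measurable_kickWeight (Eventually.of_forall kickWeight_nonneg) integrable_kickWeight
    (measurable_kickMap ht.measurable_G) (fun w => t / 2 * s w) i4).trans ?_
  have e1 : ∫ w, kickWeight P G δ (σ t) t w ∂P = t ^ 2 * R t := integral_const_mul _ _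
  have e2 : ∫ w, (√(1 + t * σ t w - kickWeight P G δ (σ t) t w) - 1 - t / 2 * s w) ^ 2 ∂P ≤
      t ^ 2 * (12 * κ t ^ 2 * (I t + S) + 2 * I t + 4 * R t) := by
    refine (integral_mono_ae i4 (i3.const_mul (t ^ 2)) hptw).trans_eq ?_
    rw [integral_const_mul, integral_add i2 (hrq.const_mul 4), integral_add i1 (hdq.const_mul 2),
      integral_const_mul, integral_const_mul, integral_const_mul, integral_add hdq hsq]
  rw [e1]
  calc _ ≤ 2 * (t ^ 2 * R t) + 2 * (t ^ 2 * (12 * κ t ^ 2 * (I t + S) + 2 * I t + 4 * R t)) := by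
        gcongr
    _ = _ := by ring

theorem integrable_X_mul_δ (h : IsScoreFamily P G δ D s σ v)
    (j : Fin p) : Integrable (fun w => X w j * δ (X w)) P := by
  have := h.inModel_P.isProbabilityMeasure
  have hδ := h.measurable_δ.comp (measurable_X (p := p) (q := q))
  exact ((h.inModel_P.memLp_X j).integrable one_le_two).mul_bdd (c := D) hδ.aestronglyMeasurable
    (Eventually.of_forall fun w => h.abs_δ_le _)

theorem tendsto_integral_mul_σ (h : IsScoreFamily P G δ D s σ v)
    {f : Obs p q → ℝ} (hf : Integrable f P) :
    Tendsto (fun t => ∫ w, t * σ t w * f w ∂P) (𝓝[≠] 0) (𝓝 0) := by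
  have hlim : Tendsto (fun t : ℝ => √|t| * ∫ w, |f w| ∂P) (𝓝[≠] 0) (𝓝 0) := by
    simpa using tendsto_sqrt_abs.mul_const (∫ w, |f w| ∂P)
  refine squeeze_zero_norm' ?_ hlim
  filter_upwards [h.abs_mul_le] with t ht
  rw [← integral_const_mul]
  refine norm_integral_le_of_norm_le (hf.abs.const_mul _) (Eventually.of_forall fun w => ?_)
  rw [Real.norm_eq_abs, abs_mul]
  exact mul_le_mul_of_nonneg_right (ht w) (abs_nonneg _)

theorem integrable_mul_σ (h : IsScoreFamily P G δ D s σ v)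
    {t : ℝ} (ht : IsSmallPerturbation P G δ D (σ t) t) {f : Obs p q → ℝ}
    (hf : Integrable f P) : Integrable (fun w => t * σ t w * f w) P :=
  hf.bdd_mul ((h.measurable_σ t).const_mul t).aestronglyMeasurable
    (Eventually.of_forall ht.abs_mul_le)

theorem integral_one_add_mul (h : IsScoreFamily P G δ D s σ v)
    {t : ℝ} (ht : IsSmallPerturbation P G δ D (σ t) t) {f : Obs p q → ℝ}
    (hf : Integrable f P) :
    ∫ w, (1 + t * σ t w) * f w ∂P = ∫ w, f w ∂P + ∫ w, t * σ t w * f w ∂P := by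
  rw [← integral_add hf (h.integrable_mul_σ ht hf)]
  exact integral_congr_ae (Eventually.of_forall fun w => by simp only; ring)

theorem tendsto_secondMoment (h : IsScoreFamily P G δ D s σ v) :
    Tendsto (fun t => secondMoment (perturbedLaw P G δ (σ t) t)) (𝓝[≠] 0)
      (𝓝 (secondMoment P)) := by
  refine tendsto_pi_nhds.2 fun i => tendsto_pi_nhds.2 fun j => ?_
  have hX := h.inModel_P.memLp_X
  have hi : Integrable (fun w => X w i * X w j) P := (hX i).integrable_mul (hX j)
  have h1 := (h.tendsto_integral_mul_σ hi).const_add (∫ w, X w i * X w j ∂P)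
  rw [add_zero] at h1
  refine h1.congr' ?_
  filter_upwards [h.eventually_isSmallPerturbation] with t ht
  rw [← h.integral_one_add_mul ht hi]
  exact (ht.integral_comp_X (φ := fun x => x i * x j) (by fun_prop)).symm

theorem integrable_X_mul_resid (h : IsScoreFamily P G δ D s σ v) (j : Fin p) :
    Integrable (fun w => X w j * (G (X w) - X w ⬝ᵥ beta P G)) P := by
  have hX := h.inModel_P.memLp_X
  refine (hX j).integrable_mul ((h.inModel_P.memLp_comp_X h.measurable_G).sub ?_)
  exact memLp_finsetSum _ fun k _ => (hX k).mul_const _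

/-- The normal equations give `E[X (G(X) - X'β)] = 0` under `P`, so writing the difference through
the projection residual leaves only terms with a factor `t`. The inverse second moment matrix then
needs only to be continuous in `t`, not differentiable. -/
theorem beta_sub_eq (h : IsScoreFamily P G δ D s σ v)
    {t : ℝ} (ht : IsSmallPerturbation P G δ D (σ t) t) :
    beta (perturbedLaw P G δ (σ t) t) (fun x => G x + t * δ x) - beta P G =
      t • ((secondMoment (perturbedLaw P G δ (σ t) t))⁻¹ *ᵥ fun j =>
        ∫ w, X w j * (G (X w) - X w ⬝ᵥ beta P G) * σ t w ∂P + ∫ w, X w j * δ (X w) ∂P +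
          ∫ w, t * σ t w * (X w j * δ (X w)) ∂P) := by
  have hP := h.inModel_P
  have hQ := ht.inModel hP h.memLp_error (hP.condExp_error h.measurable_G)
  set Q := perturbedLaw P G δ (σ t) t with hQdef
  have hGm := h.measurable_G
  have hδm := h.measurable_δ
  have hgm : Measurable fun x => G x + t * δ x := by fun_prop
  have hunit : IsUnit (secondMoment Q).det := (Matrix.isUnit_iff_isUnit_det _).1 hQ.posDef.isUnit
  have hlin : ∀ j, ∫ w, X w j * (G (X w) + t * δ (X w)) ∂Q - (secondMoment Q *ᵥ beta P G) j =
      t * (∫ w, X w j * (G (X w) - X w ⬝ᵥ beta P G) * σ t w ∂P + ∫ w, X w j * δ (X w) ∂P +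
          ∫ w, t * σ t w * (X w j * δ (X w)) ∂P) := by
    intro j
    have hu := h.integrable_X_mul_resid j
    have hδi := h.integrable_X_mul_δ j
    have hdot : MemLp (fun w : Obs p q => X w ⬝ᵥ beta P G) 2 Q :=
      memLp_finsetSum _ fun k _ => (hQ.memLp_X k).mul_const _
    have hdotP : MemLp (fun w : Obs p q => X w ⬝ᵥ beta P G) 2 P :=
      memLp_finsetSum _ fun k _ => (hP.memLp_X k).mul_const _
    have k1 : Integrable (fun w => X w j * (G (X w) + t * δ (X w))) Q :=
      (hQ.memLp_X j).integrable_mul (hQ.memLp_comp_X hgm)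
    have k2 : Integrable (fun w => X w j * (X w ⬝ᵥ beta P G)) Q :=
      (hQ.memLp_X j).integrable_mul hdot
    have k3 : Integrable (fun w => X w j * G (X w)) P :=
      (hP.memLp_X j).integrable_mul (hP.memLp_comp_X hGm)
    have k4 : Integrable (fun w => X w j * (X w ⬝ᵥ beta P G)) P :=
      (hP.memLp_X j).integrable_mul hdotP
    have z : ∫ w, X w j * (G (X w) - X w ⬝ᵥ beta P G) ∂P = 0 := by
      have e := congrFun (secondMoment_mulVec_beta (g := G) hP.posDef) j
      rw [secondMoment_mulVec_apply hP.memLp_X] at e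
      simp_rw [mul_sub]
      rw [integral_sub k3 k4, e, sub_self]
    have hφ : Measurable fun x : Fin p → ℝ => x j * (G x + t * δ x) - x j * (x ⬝ᵥ beta P G) := by
      unfold dotProduct
      fun_prop
    have hf : Integrable (fun w => X w j * (G (X w) - X w ⬝ᵥ beta P G) +
        t * (X w j * δ (X w))) P := hu.add (hδi.const_mul t)
    rw [secondMoment_mulVec_apply hQ.memLp_X, ← integral_sub k1 k2, hQdef,
      ht.integral_comp_X hφ]
    calc _ = ∫ w, (1 + t * σ t w) * (X w j * (G (X w) - X w ⬝ᵥ beta P G) +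
          t * (X w j * δ (X w))) ∂P :=
          integral_congr_ae (Eventually.of_forall fun w => by simp only; ring)
      _ = t * ∫ w, X w j * δ (X w) ∂P + ∫ w, t * σ t w * (X w j *
          (G (X w) - X w ⬝ᵥ beta P G) + t * (X w j * δ (X w))) ∂P := by
          rw [h.integral_one_add_mul ht hf, integral_add hu (hδi.const_mul t), z, zero_add,
            integral_const_mul]
      _ = t * ∫ w, X w j * δ (X w) ∂P +
          (t * ∫ w, X w j * (G (X w) - X w ⬝ᵥ beta P G) * σ t w ∂P +
            t * ∫ w, t * σ t w * (X w j * δ (X w)) ∂P) := by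
          rw [← integral_const_mul t (fun w => X w j * (G (X w) - X w ⬝ᵥ beta P G) * σ t w),
            ← integral_const_mul t (fun w => t * σ t w * (X w j * δ (X w))), ← integral_add]
          · congr 1
            exact integral_congr_ae (Eventually.of_forall fun w => by simp only; ring)
          · exact (h.integrable_mul_σ ht hu).congr
              (Eventually.of_forall fun w => by simp only; ring)
          · exact (h.integrable_mul_σ ht hδi).const_mul t
      _ = _ := by ring
  have e1 : beta P G = (secondMoment Q)⁻¹ *ᵥ (secondMoment Q *ᵥ beta P G) := by
    rw [Matrix.mulVec_mulVec, Matrix.nonsing_inv_mul _ hunit, Matrix.one_mulVec]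
  conv_lhs => rw [e1]
  rw [beta, ← Matrix.mulVec_sub, ← Matrix.mulVec_smul]
  congr 1
  funext j
  rw [Pi.sub_apply, hlin j, Pi.smul_apply, smul_eq_mul]

theorem hasDerivAt_beta (h : IsScoreFamily P G δ D s σ v)
    (law : ℝ → Measure (Obs p q)) (hlaw0 : law 0 = P)
    (hlaw : ∀ t, t ≠ 0 → law t = perturbedLaw P G δ (σ t) t) :
    HasDerivAt (fun t => beta (law t) (fun x => G x + t * δ x))
      ((secondMoment P)⁻¹ *ᵥ fun j => ∫ w, X w j * δ (X w) ∂P + v j) 0 := by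
  rw [hasDerivAt_iff_tendsto_slope_zero]
  have hdet : (secondMoment P).det ≠ 0 := h.inModel_P.posDef.det_pos.ne'
  have h1 := tendsto_matrix_inv h.tendsto_secondMoment hdet
  have h2 : Tendsto (fun t => fun j => ∫ w, X w j * (G (X w) - X w ⬝ᵥ beta P G) * σ t w ∂P +
      ∫ w, X w j * δ (X w) ∂P + ∫ w, t * σ t w * (X w j * δ (X w)) ∂P) (𝓝[≠] 0)
      (𝓝 fun j => ∫ w, X w j * δ (X w) ∂P + v j) := by
    refine tendsto_pi_nhds.2 fun j => ?_
    have := ((h.tendsto_v j).add_const (∫ w, X w j * δ (X w) ∂P)).add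
      (h.tendsto_integral_mul_σ (h.integrable_X_mul_δ j))
    rwa [add_zero, add_comm] at this
  have h3 : Tendsto (fun t => (secondMoment (perturbedLaw P G δ (σ t) t))⁻¹ *ᵥ fun j =>
      ∫ w, X w j * (G (X w) - X w ⬝ᵥ beta P G) * σ t w ∂P + ∫ w, X w j * δ (X w) ∂P +
        ∫ w, t * σ t w * (X w j * δ (X w)) ∂P) (𝓝[≠] 0)
      (𝓝 ((secondMoment P)⁻¹ *ᵥ fun j => ∫ w, X w j * δ (X w) ∂P + v j)) := by
    have hc : Continuous fun Av : Matrix (Fin p) (Fin p) ℝ × (Fin p → ℝ) => Av.1 *ᵥ Av.2 :=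
      continuous_fst.matrix_mulVec continuous_snd
    exact (hc.tendsto ((secondMoment P)⁻¹, _)).comp (h1.prodMk_nhds h2)
  refine h3.congr' ?_
  filter_upwards [h.eventually_isSmallPerturbation, self_mem_nhdsWithin] with t ht ht0
  have ht0' : t ≠ 0 := ht0
  simp only [zero_add, zero_mul, add_zero]
  rw [hlaw0, hlaw t ht0', h.beta_sub_eq ht, smul_smul, inv_mul_cancel₀ ht0', one_smul]

/-- A score family defines a regular submodel. -/
theorem exists_regularSubmodel (h : IsScoreFamily P G δ D s σ v)
    : ∃ S : RegularSubmodel P G, S.score = s ∧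
    S.betaDot = (secondMoment P)⁻¹ *ᵥ fun j => ∫ w, X w j * δ (X w) ∂P + v j := by
  classical
  have := h.inModel_P.isProbabilityMeasure
  let law : ℝ → Measure (Obs p q) := fun t => if t = 0 then P else perturbedLaw P G δ (σ t) t
  have hlaw0 : law 0 = P := if_pos rfl
  have hlaw : ∀ t, t ≠ 0 → law t = perturbedLaw P G δ (σ t) t := fun t ht => if_neg ht
  have hnhds : ∀ {Q : ℝ → Prop}, Q 0 → (∀ᶠ t in 𝓝[≠] (0 : ℝ), Q t) → ∀ᶠ t in 𝓝 (0 : ℝ), Q t := by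
    intro Q h0 h1
    rw [eventually_nhdsWithin_iff] at h1
    filter_upwards [h1] with t ht
    rcases eq_or_ne t 0 with rfl | hne
    · exact h0
    · exact ht hne
  obtain ⟨C, hC⟩ := h.exists_eLpNorm_error_le
  have hε := h.memLp_error
  refine ⟨
    { law := law
      g := fun t x => G x + t * δ x
      score := s
      gDot := δ
      betaDot := (secondMoment P)⁻¹ *ᵥ fun j => ∫ w, X w j * δ (X w) ∂P + v j
      law_zero := hlaw0
      g_zero := by funext x; simp
      inModel := hnhds (by simpa [hlaw0] using h.inModel_P) ?_
      map_X_le := ⟨2, hnhds ?_ ?_⟩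
      error_bound := ⟨max C (eLpNorm (fun w => Y w - G (X w)) 2 P).toNNReal, hnhds ?_ ?_⟩
      qmd := h.isQMD law hlaw
      memLp_gDot := MemLp.of_bound h.measurable_δ.aestronglyMeasurable D
        (Eventually.of_forall fun x => h.abs_δ_le x)
      tendsto_g := ?_
      hasDerivAt_beta := h.hasDerivAt_beta law hlaw0 hlaw }, rfl, rfl⟩
  · filter_upwards [h.eventually_isSmallPerturbation, self_mem_nhdsWithin] with t ht ht0
    rw [hlaw t ht0]
    exact ht.inModel h.inModel_P hε (h.inModel_P.condExp_error h.measurable_G)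
  · rw [hlaw0]
    intro A
    rw [Measure.smul_apply, two_smul]
    exact le_self_add
  · filter_upwards [h.eventually_isSmallPerturbation, self_mem_nhdsWithin] with t ht ht0
    rw [hlaw t ht0]
    exact ht.map_X_le
  · simp only [hlaw0, zero_mul, add_zero]
    rw [ENNReal.coe_max, ENNReal.coe_toNNReal hε.eLpNorm_ne_top]
    exact le_max_right _ _
  · filter_upwards [hC, self_mem_nhdsWithin] with t ht ht0
    rw [hlaw t ht0, ENNReal.coe_max]
    exact ht.trans (le_max_left _ _)
  · refine Tendsto.congr' ?_ tendsto_const_nhds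
    filter_upwards [self_mem_nhdsWithin] with t ht
    have ht' : t ≠ 0 := ht
    have : (fun x => (G x + t * δ x - G x) / t - δ x) = fun _ => 0 := by
      funext x
      field_simp
      ring
    rw [this]
    simp

end IsScoreFamily

end OLIVA

/-! ### From finite efficiency bounds to the domination inequality -/

namespace OLIVA

variable {p q : ℕ} {P : Measure (Obs p q)} {G δ : (Fin p → ℝ) → ℝ} {D : ℝ}

/-- A sequence of constants can be run through slowly enough to be negligible against
`|t| ^ (-1/2)` as `t → 0`. -/
theorem exists_tendsto_atTop_mul_le (M : ℕ → ℝ) : ∃ n : ℝ → ℕ, Tendsto n (𝓝[≠] 0) atTop ∧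
    ∀ᶠ t in 𝓝[≠] (0 : ℝ), |t| * M (n t) ≤ √|t| := by
  classical
  have hM : ∀ N, ∀ᶠ t in 𝓝[≠] (0 : ℝ), |t| * M N ≤ √|t| := by
    intro N
    have h1 : Tendsto (fun t : ℝ => √|t| * M N) (𝓝[≠] 0) (𝓝 0) := by
      simpa using tendsto_sqrt_abs.mul_const (M N)
    filter_upwards [h1.eventually_le_const (show (0 : ℝ) < 1 by norm_num)] with t ht
    calc |t| * M N = √|t| * (√|t| * M N) := by
          rw [← mul_assoc, Real.mul_self_sqrt (abs_nonneg t)]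
      _ ≤ √|t| * 1 := by gcongr
      _ = √|t| := mul_one _
  have hinv : Tendsto (fun t : ℝ => |t|⁻¹) (𝓝[≠] 0) atTop := by
    refine Tendsto.inv_tendsto_nhdsGT_zero ?_
    refine tendsto_nhdsWithin_iff.2 ⟨?_, ?_⟩
    · have h := (continuous_abs (G := ℝ)).tendsto 0
      rw [abs_zero] at h
      exact h.mono_left nhdsWithin_le_nhds
    · filter_upwards [self_mem_nhdsWithin] with t ht
      exact abs_pos.2 ht
  -- The largest admissible index up to `1/|t|`. Each fixed index is eventually admissible, so it
  -- tends to infinity, and index `0` being eventually admissible makes the search succeed.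
  refine ⟨fun t => Nat.findGreatest (fun n => |t| * M n ≤ √|t|) ⌊|t|⁻¹⌋₊, ?_, ?_⟩
  · refine tendsto_atTop.2 fun N => ?_
    filter_upwards [hM N, hinv.eventually_ge_atTop (N : ℝ)] with t h1 h2
    exact Nat.le_findGreatest (Nat.le_floor h2) h1
  · filter_upwards [hM 0] with t h0
    exact Nat.findGreatest_spec (P := fun n => |t| * M n ≤ √|t|) (Nat.zero_le _) h0

/-- A sequence of bounded mean-zero functions that converges to `s`, where `s` is compatible with
the direction `δ` of the structural function, defines a regular submodel with score `s`. -/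
theorem exists_regularSubmodel_of_seq (hG : Measurable G) (hP : InModel P G)
    (hvar : BoundedCondVariance P G) (hδ : Measurable δ) (hD : ∀ x, |δ x| ≤ D) {s : Obs p q → ℝ}
    (hs : MemLp s 2 P) (hsδ : P[fun w => s w * (Y w - G (X w)) | sigmaZ p q] =ᵐ[P]
      P[fun w => δ (X w) | sigmaZ p q]) {σ : ℕ → Obs p q → ℝ} (hσ : ∀ n, Measurable (σ n))
    (hσb : ∀ n, ∃ M, ∀ w, |σ n w| ≤ M) (hσ0 : ∀ n, ∫ w, σ n w ∂P = 0)
    (hσs : Tendsto (fun n => ∫ w, (σ n w - s w) ^ 2 ∂P) atTop (𝓝 0)) {v : Fin p → ℝ}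
    (hv : ∀ j, Tendsto (fun n => ∫ w, X w j * (G (X w) - X w ⬝ᵥ beta P G) * σ n w ∂P) atTop
      (𝓝 (v j))) :
    ∃ S : RegularSubmodel P G, S.score = s ∧
      S.betaDot = (secondMoment P)⁻¹ *ᵥ fun j => ∫ w, X w j * δ (X w) ∂P + v j := by
  choose M hM using hσb
  obtain ⟨n, hn, hnM⟩ := exists_tendsto_atTop_mul_le M
  have h : IsScoreFamily P G δ D s (fun t => σ (n t)) v :=
    { measurable_G := hG
      inModel_P := hP
      boundedCondVariance := hvar
      measurable_δ := hδ
      abs_δ_le := hD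
      memLp_s := hs
      condExp_s := hsδ
      measurable_σ := fun t => hσ _
      abs_mul_le := by
        filter_upwards [hnM] with t ht w
        rw [abs_mul]
        exact (mul_le_mul_of_nonneg_left (hM _ w) (abs_nonneg _)).trans ht
      integral_σ := fun t => hσ0 _
      tendsto_σ := hσs.comp hn
      tendsto_v := fun j => (hv j).comp hn }
  exact h.exists_regularSubmodel

/-- The efficiency bound does not depend on the version of the structural function. -/
theorem efficiencyBound_le_of_ae_eq {g₀ : (Fin p → ℝ) → ℝ} (hP : InModel P g₀)
    (hae : g₀ =ᵐ[P.map X] G) (c : Fin p → ℝ) :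
    efficiencyBound P G c ≤ efficiencyBound P g₀ c := by
  classical
  refine iSup_le fun S => ?_
  have haeX : ∀ᵐ w ∂P, g₀ (X w) = G (X w) := ae_of_ae_map measurable_X.aemeasurable hae
  have hupd : ∀ t, t ≠ 0 → Function.update S.g 0 g₀ t = S.g t := fun t ht =>
    Function.update_of_ne ht _ _
  have hnhds : ∀ {Q R : ℝ → Prop}, R 0 → (∀ t, t ≠ 0 → Q t → R t) →
      (∀ᶠ t in 𝓝 (0 : ℝ), Q t) → ∀ᶠ t in 𝓝 (0 : ℝ), R t := by
    intro Q R h0 h1 h2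
    filter_upwards [h2] with t ht
    rcases eq_or_ne t 0 with rfl | hne
    · exact h0
    · exact h1 t hne ht
  have hbeta : ∀ t, beta (S.law t) (Function.update S.g 0 g₀ t) = beta (S.law t) (S.g t) := by
    intro t
    rcases eq_or_ne t 0 with rfl | hne
    · rw [Function.update_self, S.law_zero, S.g_zero, beta, beta]
      congr 1
      funext j
      exact integral_congr_ae (haeX.mono fun w hw => by simp only [hw])
    · rw [hupd t hne]
  let S' : RegularSubmodel P g₀ :=
    { law := S.law
      g := Function.update S.g 0 g₀
      score := S.score
      gDot := S.gDot
      betaDot := S.betaDot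
      law_zero := S.law_zero
      g_zero := Function.update_self _ _ _
      inModel := hnhds (by rw [S.law_zero, Function.update_self]; exact hP)
        (fun t ht h => by rwa [hupd t ht]) S.inModel
      map_X_le := S.map_X_le
      error_bound := by
        obtain ⟨C, hC⟩ := S.error_bound
        refine ⟨C, hnhds ?_ (fun t ht h => by rwa [hupd t ht]) hC⟩
        have h0 := hC.self_of_nhds
        rw [S.law_zero, S.g_zero] at h0
        rw [S.law_zero, Function.update_self]
        rwa [eLpNorm_congr_ae (haeX.mono fun w hw => by rw [hw])]
      qmd := S.qmd
      memLp_gDot := S.memLp_gDot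
      tendsto_g := by
        refine S.tendsto_g.congr' ?_
        filter_upwards [self_mem_nhdsWithin] with t ht
        rw [hupd t ht]
        exact eLpNorm_congr_ae (hae.mono fun x hx => by simp only [hx])
      hasDerivAt_beta := by
        simp only [hbeta]
        exact S.hasDerivAt_beta }
  exact le_iSup_of_le S' le_rfl

/-- Finiteness of the efficiency bounds, as an inequality on regular submodels. -/
theorem exists_sq_mulVec_betaDot_le (hfin : ∀ c, efficiencyBound P G c < ⊤) (j : Fin p) :
    ∃ B, 0 ≤ B ∧ ∀ S : RegularSubmodel P G,
      (secondMoment P *ᵥ S.betaDot) j ^ 2 ≤ B * ∫ w, S.score w ^ 2 ∂P := by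
  -- Row `j` of `E[XX']`, chosen to cancel the factor `E[XX']⁻¹` in `β̇`.
  set c : Fin p → ℝ := fun k => secondMoment P j k
  refine ⟨(efficiencyBound P G c).toReal, ENNReal.toReal_nonneg, fun S => ?_⟩
  have h1 : ENNReal.ofReal ((c ⬝ᵥ S.betaDot) ^ 2) / ENNReal.ofReal (∫ w, S.score w ^ 2 ∂P) ≤
      efficiencyBound P G c :=
    le_iSup (fun S : RegularSubmodel P G => ENNReal.ofReal ((c ⬝ᵥ S.betaDot) ^ 2) /
      ENNReal.ofReal (∫ w, S.score w ^ 2 ∂P)) S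
  -- Finiteness of the bound covers the degenerate case: a zero score forces `c'β̇ = 0`.
  rw [ENNReal.div_le_iff_le_mul (Or.inr (hfin c).ne) (Or.inl ENNReal.ofReal_ne_top)] at h1
  have hI : 0 ≤ ∫ w, S.score w ^ 2 ∂P := integral_nonneg fun w => sq_nonneg _
  have h2 := ENNReal.toReal_mono (ENNReal.mul_ne_top (hfin c).ne ENNReal.ofReal_ne_top) h1
  rwa [ENNReal.toReal_mul, ENNReal.toReal_ofReal (sq_nonneg _), ENNReal.toReal_ofReal hI] at h2

/-- The derivative of `β`, up to the factor `E[X X']⁻¹`, in the direction of the score `s`. -/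
def scoreMoment (P : Measure (Obs p q)) (G : (Fin p → ℝ) → ℝ) (s : Obs p q → ℝ) : Fin p → ℝ :=
  fun j => ∫ w, X w j * (G (X w) - X w ⬝ᵥ beta P G) * s w ∂P

/-- The finite bound applied to the constructed submodels. The limit `v` is kept free of `s`, so
that the case `δ = 0`, `s = 0` with arbitrary `v` remains available. -/
theorem exists_sq_add_le (hG : Measurable G) (hP : InModel P G)
    (hvar : BoundedCondVariance P G) (hfin : ∀ c, efficiencyBound P G c < ⊤) (j : Fin p) :
    ∃ B, 0 ≤ B ∧ ∀ (δ : (Fin p → ℝ) → ℝ) (D : ℝ), Measurable δ → (∀ x, |δ x| ≤ D) →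
      ∀ s : Obs p q → ℝ, MemLp s 2 P → P[fun w => s w * (Y w - G (X w)) | sigmaZ p q] =ᵐ[P]
        P[fun w => δ (X w) | sigmaZ p q] → ∀ σ : ℕ → Obs p q → ℝ, (∀ n, Measurable (σ n)) →
      (∀ n, ∃ M, ∀ w, |σ n w| ≤ M) → (∀ n, ∫ w, σ n w ∂P = 0) →
      Tendsto (fun n => ∫ w, (σ n w - s w) ^ 2 ∂P) atTop (𝓝 0) →
      ∀ v, Tendsto (fun n => scoreMoment P G (σ n)) atTop (𝓝 v) →
      (∫ w, X w j * δ (X w) ∂P + v j) ^ 2 ≤ B * ∫ w, s w ^ 2 ∂P := by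
  obtain ⟨B, hB, h⟩ := exists_sq_mulVec_betaDot_le hfin j
  refine ⟨B, hB, fun δ D hδ hD s hs hsδ σ hσ hσb hσ0 hσs v hv => ?_⟩
  obtain ⟨S, rfl, hS⟩ := exists_regularSubmodel_of_seq hG hP hvar hδ hD hs hsδ hσ hσb hσ0 hσs
    (tendsto_pi_nhds.1 hv)
  have h1 := h S
  have hunit : IsUnit (secondMoment P).det := (Matrix.isUnit_iff_isUnit_det _).1 hP.posDef.isUnit
  rwa [hS, Matrix.mulVec_mulVec, Matrix.mul_nonsing_inv _ hunit, Matrix.one_mulVec] at h1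

theorem scoreMoment_const_mul (a : ℝ) (s : Obs p q → ℝ) :
    scoreMoment P G (fun w => a * s w) = a • scoreMoment P G s := by
  funext j
  rw [Pi.smul_apply, smul_eq_mul, scoreMoment, scoreMoment, ← integral_const_mul]
  exact integral_congr_ae (Eventually.of_forall fun w => by simp only; ring)

/-- If the efficiency bounds are finite, then the derivative of `β` is a bounded function of the
score. -/
theorem exists_norm_scoreMoment_le (hG : Measurable G) (hP : InModel P G)
    (hvar : BoundedCondVariance P G) (hfin : ∀ c, efficiencyBound P G c < ⊤) :
    ∃ K, 0 ≤ K ∧ ∀ s : Obs p q → ℝ, Measurable s → (∃ M, ∀ w, |s w| ≤ M) → ∫ w, s w ∂P = 0 →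
      ‖scoreMoment P G s‖ ≤ K * √(∫ w, s w ^ 2 ∂P) := by
  by_contra! hcon
  choose σ hσ hσb hσ0 hσK using fun n : ℕ => hcon (n + 1) (by positivity)
  have hpos : ∀ n, 0 < ‖scoreMoment P G (σ n)‖ := fun n =>
    lt_of_le_of_lt (by positivity) (hσK n)
  -- Normalised so that the score moments lie on the unit sphere while the `L₂` norms tend to zero.
  set ρ : ℕ → Obs p q → ℝ := fun n w => ‖scoreMoment P G (σ n)‖⁻¹ * σ n w with hρ
  have hρm : ∀ n, scoreMoment P G (ρ n) ∈ Metric.sphere (0 : Fin p → ℝ) 1 := by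
    intro n
    rw [mem_sphere_zero_iff_norm, hρ, scoreMoment_const_mul, norm_smul, norm_inv, norm_norm,
      inv_mul_cancel₀ (hpos n).ne']
  obtain ⟨v, hv, φ, hφ, hlim⟩ := (isCompact_sphere (0 : Fin p → ℝ) 1).tendsto_subseq hρm
  have hρ2 : ∀ n : ℕ, ∫ w, ρ n w ^ 2 ∂P ≤ 1 / ((n : ℝ) + 1) := by
    intro n
    have h1 : ∫ w, ρ n w ^ 2 ∂P =
        (‖scoreMoment P G (σ n)‖⁻¹) ^ 2 * ∫ w, σ n w ^ 2 ∂P := by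
      rw [← integral_const_mul]
      exact integral_congr_ae (Eventually.of_forall fun w => by simp only [hρ]; ring)
    have hI : 0 ≤ ∫ w, σ n w ^ 2 ∂P := integral_nonneg fun w => sq_nonneg _
    have h2 := pow_le_pow_left₀ (by positivity) (hσK n).le 2
    rw [mul_pow, Real.sq_sqrt hI] at h2
    rw [h1, inv_pow, inv_mul_le_iff₀ (by have := hpos n; positivity), mul_one_div,
      le_div_iff₀ (by positivity)]
    refine le_trans ?_ h2
    rw [mul_comm]
    exact mul_le_mul_of_nonneg_right
      (le_self_pow₀ (by linarith [n.cast_nonneg (α := ℝ)]) two_ne_zero) hI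
  have hρ0 : Tendsto (fun n => ∫ w, ρ n w ^ 2 ∂P) atTop (𝓝 0) :=
    squeeze_zero (fun n => integral_nonneg fun w => sq_nonneg _) hρ2
      tendsto_one_div_add_atTop_nhds_zero_nat
  have hv0 : v = 0 := by
    funext j
    obtain ⟨B, -, hB⟩ := exists_sq_add_le hG hP hvar hfin j
    -- A submodel with constant structural function and zero score, whose `β` nevertheless moves in
    -- direction `E[XX']⁻¹ v`; the finite bound forces `v = 0`.
    have h1 := hB 0 0 measurable_const (by simp) 0 MemLp.zero'
      (by simp only [Pi.zero_apply, zero_mul]; rfl) (fun n => ρ (φ n)) (fun n => (hσ _).const_mul _)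
      (fun n => by
        obtain ⟨M, hM⟩ := hσb (φ n)
        refine ⟨‖scoreMoment P G (σ (φ n))‖⁻¹ * M, fun w => ?_⟩
        rw [hρ, abs_mul, abs_inv, abs_norm]
        exact mul_le_mul_of_nonneg_left (hM w) (by positivity))
      (fun n => by rw [hρ, integral_const_mul, hσ0, mul_zero])
      (by simpa [Function.comp_def] using hρ0.comp hφ.tendsto_atTop) v hlim
    simp only [Pi.zero_apply, mul_zero, integral_zero, zero_add, ne_eq, OfNat.ofNat_ne_zero,
      not_false_eq_true, zero_pow] at h1
    exact pow_eq_zero_iff two_ne_zero |>.1 (le_antisymm h1 (sq_nonneg _))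
  rw [hv0, mem_sphere_zero_iff_norm, norm_zero] at hv
  exact zero_ne_one hv

/-- Truncating and centring a mean-zero square integrable function. -/
theorem exists_bounded_seq_tendsto {Ω : Type*} [MeasurableSpace Ω] {μ : Measure Ω}
    [IsProbabilityMeasure μ] {s : Ω → ℝ} (hsm : Measurable s) (hs : MemLp s 2 μ)
    (hs0 : ∫ w, s w ∂μ = 0) :
    ∃ σ : ℕ → Ω → ℝ, (∀ n, Measurable (σ n)) ∧ (∀ n, ∃ M, ∀ w, |σ n w| ≤ M) ∧
      (∀ n, ∫ w, σ n w ∂μ = 0) ∧ Tendsto (fun n => ∫ w, (σ n w - s w) ^ 2 ∂μ) atTop (𝓝 0) ∧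
      ∀ n, ∫ w, σ n w ^ 2 ∂μ ≤ ∫ w, s w ^ 2 ∂μ := by
  have hcentre : ∀ g : Ω → ℝ, MemLp g 2 μ →
      ∫ w, (g w - ∫ w, g w ∂μ) ^ 2 ∂μ ≤ ∫ w, g w ^ 2 ∂μ := by
    intro g hg
    have hgi := hg.integrable one_le_two
    set m := ∫ w, g w ∂μ
    have : ∫ w, (g w - m) ^ 2 ∂μ = ∫ w, g w ^ 2 ∂μ - m ^ 2 := by
      have e : ∀ w, (g w - m) ^ 2 = g w ^ 2 - (2 * m * g w - m ^ 2) := fun w => by ring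
      simp_rw [e]
      have i1 : Integrable (fun w => 2 * m * g w - m ^ 2) μ :=
        (hgi.const_mul _).sub (integrable_const _)
      rw [integral_sub hg.integrable_sq i1, integral_sub (hgi.const_mul _) (integrable_const _),
        integral_const_mul]
      simp only [integral_const, probReal_univ, smul_eq_mul, one_mul]
      ring
    rw [this]
    linarith [sq_nonneg m]
  set A : ℕ → Set Ω := fun n => {w | |s w| ≤ n}
  have hA : ∀ n, MeasurableSet (A n) := fun n => measurableSet_le hsm.abs measurable_const
  set f : ℕ → Ω → ℝ := fun n => (A n).indicator s
  have hfm : ∀ n, Measurable (f n) := fun n => hsm.indicator (hA n)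
  have hfb : ∀ n w, |f n w| ≤ n := by
    intro n w
    by_cases hw : w ∈ A n
    · simp only [f, Set.indicator_of_mem hw]
      exact hw
    · simp [f, Set.indicator_of_notMem hw]
  have hf2 : ∀ n, MemLp (f n) 2 μ := fun n => hs.indicator (hA n)
  have hfi : ∀ n, Integrable (f n) μ := fun n => (hf2 n).integrable one_le_two
  refine ⟨fun n w => f n w - ∫ w, f n w ∂μ, fun n => (hfm n).sub_const _, fun n => ?_, fun n => ?_,
    ?_, fun n => ?_⟩
  · exact ⟨n + |∫ w, f n w ∂μ|, fun w => (abs_sub _ _).trans (by gcongr; exact hfb n w)⟩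
  · rw [integral_sub (hfi n) (integrable_const _)]
    simp
  · have hlim : Tendsto (fun n => ∫ w, (f n w - s w) ^ 2 ∂μ) atTop (𝓝 (∫ _, (0 : ℝ) ∂μ)) := by
      refine tendsto_integral_of_dominated_convergence (fun w => s w ^ 2)
        (fun n => (((hfm n).sub hsm).pow_const 2).aestronglyMeasurable) hs.integrable_sq
        (fun n => Eventually.of_forall fun w => ?_) (Eventually.of_forall fun w => ?_)
      · by_cases hw : w ∈ A n
        · simp [f, Set.indicator_of_mem hw, sq_nonneg]
        · simp [f, Set.indicator_of_notMem hw]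
      · refine tendsto_const_nhds.congr' ?_
        filter_upwards [eventually_ge_atTop ⌈|s w|⌉₊] with n hn
        have hw : w ∈ A n := Nat.ceil_le.1 hn
        simp [f, Set.indicator_of_mem hw]
    rw [integral_zero] at hlim
    refine squeeze_zero (fun n => integral_nonneg fun w => sq_nonneg _) (fun n => ?_) hlim
    have h1 := hcentre _ ((hf2 n).sub hs)
    simp only [Pi.sub_apply] at h1
    rw [integral_sub (hfi n) (hs.integrable one_le_two), hs0, sub_zero] at h1
    refine le_trans (le_of_eq ?_) h1
    exact integral_congr_ae (Eventually.of_forall fun w => by simp only; ring)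
  · refine (hcentre _ (hf2 n)).trans ?_
    refine integral_mono (hf2 n).integrable_sq hs.integrable_sq fun w => ?_
    by_cases hw : w ∈ A n
    · simp [f, Set.indicator_of_mem hw]
    · simp [f, Set.indicator_of_notMem hw, sq_nonneg]

/-- The least favourable score for the direction `δ` of the structural function. -/
theorem exists_score (hG : Measurable G) (hP : InModel P G) {c : ℝ} (hc : 0 < c)
    (hΩ : ∀ᵐ w ∂P, c ≤ (P[fun w => (Y w - G (X w)) ^ 2 | sigmaZ p q]) w)
    (hε : MemLp (fun w => Y w - G (X w)) 2 P) (hδ : Measurable δ) (hD : ∀ x, |δ x| ≤ D) :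
    ∃ s : Obs p q → ℝ, Measurable s ∧ MemLp s 2 P ∧ ∫ w, s w ∂P = 0 ∧
      P[fun w => s w * (Y w - G (X w)) | sigmaZ p q] =ᵐ[P] P[fun w => δ (X w) | sigmaZ p q] ∧
      ∫ w, s w ^ 2 ∂P ≤ c⁻¹ * ∫ w, (P[fun w => δ (X w) | sigmaZ p q]) w ^ 2 ∂P := by
  have := hP.isProbabilityMeasure
  have hδc : Measurable fun w : Obs p q => δ (X w) := hδ.comp measurable_X
  have hδ2 : MemLp (fun w : Obs p q => δ (X w)) 2 P :=
    MemLp.of_bound hδc.aestronglyMeasurable D (Eventually.of_forall fun w => hD _)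
  set ε : Obs p q → ℝ := fun w => Y w - G (X w) with hεdef
  have hεm : Measurable ε := measurable_Y.sub (hG.comp measurable_X)
  set τ := P[fun w => δ (X w) | sigmaZ p q] with hτ
  set Ω := P[fun w => ε w ^ 2 | sigmaZ p q] with hΩdef
  have hτZ : StronglyMeasurable[sigmaZ p q] τ := stronglyMeasurable_condExp
  have hΩZ : StronglyMeasurable[sigmaZ p q] Ω := stronglyMeasurable_condExp
  have hτ2 : MemLp τ 2 P := hδ2.condExp one_le_two
  have hτD : ∀ᵐ w ∂P, |τ w| ≤ D := by
    have h1 : τ ≤ᵐ[P] P[fun _ => D | sigmaZ p q] :=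
      condExp_mono (hδ2.integrable one_le_two) (integrable_const _)
        (Eventually.of_forall fun w => (abs_le.1 (hD _)).2)
    have h2 : P[fun _ => -D | sigmaZ p q] ≤ᵐ[P] τ :=
      condExp_mono (integrable_const _) (hδ2.integrable one_le_two)
        (Eventually.of_forall fun w => (abs_le.1 (hD _)).1)
    rw [condExp_const sigmaZ_le] at h1 h2
    filter_upwards [h1, h2] with w h3 h4
    exact abs_le.2 ⟨h4, h3⟩
  -- With `s = a ε`, `E[s ε | Z] = a Ω = τ` and `E[s²] = E[τ² / Ω]`. Boundedness of `δ` and the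
  -- lower bound on `Ω` make `a` bounded.
  set a : Obs p q → ℝ := τ / Ω with ha
  have haZ : StronglyMeasurable[sigmaZ p q] a :=
    (hτZ.measurable.div hΩZ.measurable).stronglyMeasurable
  have ham : Measurable a := (haZ.mono sigmaZ_le).measurable
  have hab : ∀ᵐ w ∂P, ‖a w‖ ≤ D / c := by
    filter_upwards [hτD, hΩ] with w h1 h2
    have hD0 : 0 ≤ D := (abs_nonneg _).trans h1
    rw [Real.norm_eq_abs, ha, Pi.div_apply, abs_div]
    exact div_le_div₀ hD0 h1 hc (h2.trans (le_abs_self _))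
  have hεi : Integrable ε P := hε.integrable one_le_two
  have hεq : Integrable (fun w => ε w ^ 2) P := hε.integrable_sq
  have haε : Integrable (fun w => a w * ε w) P := hεi.bdd_mul ham.aestronglyMeasurable hab
  have haεq : Integrable (fun w => a w * ε w ^ 2) P := hεq.bdd_mul ham.aestronglyMeasurable hab
  have hs2 : MemLp (fun w => a w * ε w) 2 P := by
    refine (hε.const_mul (D / c)).mono (ham.mul hεm).aestronglyMeasurable ?_
    filter_upwards [hab] with w hw
    rw [norm_mul, norm_mul]
    exact mul_le_mul_of_nonneg_right (hw.trans (le_abs_self _)) (norm_nonneg _)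
  have hce : P[fun w => a w * ε w ^ 2 | sigmaZ p q] =ᵐ[P] τ := by
    filter_upwards [condExp_mul_of_stronglyMeasurable_left haZ haεq hεq, hΩ] with w h1 h2
    refine h1.trans ?_
    rw [Pi.mul_apply, ha, Pi.div_apply]
    exact div_mul_cancel₀ _ (hc.trans_le h2).ne'
  refine ⟨fun w => a w * ε w, ham.mul hεm, hs2, ?_, ?_, ?_⟩
  · rw [← integral_condExp (sigmaZ_le (p := p) (q := q)), integral_congr_ae (g := 0)]
    · simp
    · filter_upwards [condExp_mul_of_stronglyMeasurable_left haZ haε hεi,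
        hP.condExp_error hG] with w h1 h2
      refine h1.trans ?_
      rw [Pi.mul_apply, h2]
      simp
  · have : (fun w => a w * ε w * (Y w - G (X w))) = fun w => a w * ε w ^ 2 := by
      funext w
      simp only [hεdef]
      ring
    rw [this]
    exact hce
  · have haτ : Integrable (fun w => a w * τ w) P :=
      (hτ2.integrable one_le_two).bdd_mul ham.aestronglyMeasurable hab
    have haa : Integrable (fun w => a w * (a w * ε w ^ 2)) P :=
      haεq.bdd_mul ham.aestronglyMeasurable hab
    have e1 : ∫ w, (a w * ε w) ^ 2 ∂P = ∫ w, a w * τ w ∂P := by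
      have e2 : (fun w => (a w * ε w) ^ 2) = fun w => a w * (a w * ε w ^ 2) := by
        funext w; ring
      rw [e2, ← integral_condExp (sigmaZ_le (p := p) (q := q))]
      refine integral_congr_ae ?_
      filter_upwards [condExp_mul_of_stronglyMeasurable_left haZ haa haεq, hce] with w h1 h2
      refine h1.trans ?_
      rw [Pi.mul_apply, h2]
    rw [e1, ← integral_const_mul]
    refine integral_mono_ae haτ (hτ2.integrable_sq.const_mul _) ?_
    filter_upwards [hΩ] with w hw
    have hΩ0 : 0 < Ω w := hc.trans_le hw
    rw [ha, Pi.div_apply]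
    calc τ w / Ω w * τ w = (Ω w)⁻¹ * τ w ^ 2 := by ring
      _ ≤ c⁻¹ * τ w ^ 2 := by gcongr

/-- If the efficiency bounds are finite, then `δ ↦ E[X δ(X)]` is dominated by `δ ↦ E[δ(X) | Z]`. -/
theorem exists_abs_integral_le (hG : Measurable G) (hP : InModel P G)
    (hvar : BoundedCondVariance P G) (hfin : ∀ c, efficiencyBound P G c < ⊤) (j : Fin p) :
    ∃ K, ∀ (δ : (Fin p → ℝ) → ℝ) (D : ℝ), Measurable δ → (∀ x, |δ x| ≤ D) →
      |∫ w, X w j * δ (X w) ∂P| ≤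
        K * √(∫ w, (P[fun w => δ (X w) | sigmaZ p q]) w ^ 2 ∂P) := by
  have := hP.isProbabilityMeasure
  obtain ⟨B, hB0, hB⟩ := exists_sq_add_le hG hP hvar hfin j
  obtain ⟨K, hK0, hK⟩ := exists_norm_scoreMoment_le hG hP hvar hfin
  have hε := memLp_error_of_boundedCondVariance hG hvar
  obtain ⟨c, C, hc, hΩ⟩ := hvar
  refine ⟨(√B + K) * √c⁻¹, fun δ D hδ hD => ?_⟩
  obtain ⟨s, hsm, hs, hs0, hsδ, hsle⟩ :=
    exists_score hG hP hc (hΩ.mono fun w hw => hw.1) hε hδ hD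
  obtain ⟨σ, hσ, hσb, hσ0, hσs, hσle⟩ := exists_bounded_seq_tendsto hsm hs hs0
  set I := √(∫ w, s w ^ 2 ∂P) with hI
  have hball : ∀ n, scoreMoment P G (σ n) ∈ Metric.closedBall (0 : Fin p → ℝ) (K * I) := by
    intro n
    rw [mem_closedBall_zero_iff]
    exact (hK _ (hσ n) (hσb n) (hσ0 n)).trans
      (mul_le_mul_of_nonneg_left (Real.sqrt_le_sqrt (hσle n)) hK0)
  -- The score moments are bounded along the truncations, so a subsequence supplies the limit `v`
  -- that the submodel construction needs.
  obtain ⟨v, hv, φ, hφ, hlim⟩ :=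
    (isCompact_closedBall (0 : Fin p → ℝ) (K * I)).tendsto_subseq hball
  have h1 := hB δ D hδ hD s hs hsδ (fun n => σ (φ n)) (fun n => hσ _) (fun n => hσb _)
    (fun n => hσ0 _) (hσs.comp hφ.tendsto_atTop) v hlim
  have h2 : |∫ w, X w j * δ (X w) ∂P + v j| ≤ √B * I := by
    rw [hI, ← Real.sqrt_mul hB0]
    exact Real.abs_le_sqrt h1
  have h3 : |v j| ≤ K * I := (norm_le_pi_norm v j).trans (mem_closedBall_zero_iff.1 hv)
  have h4 : I ≤ √c⁻¹ * √(∫ w, (P[fun w => δ (X w) | sigmaZ p q]) w ^ 2 ∂P) := by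
    rw [← Real.sqrt_mul (by positivity)]
    exact Real.sqrt_le_sqrt hsle
  calc |∫ w, X w j * δ (X w) ∂P| = |(∫ w, X w j * δ (X w) ∂P + v j) - v j| := by ring_nf
    _ ≤ |∫ w, X w j * δ (X w) ∂P + v j| + |v j| := abs_sub _ _
    _ ≤ √B * I + K * I := add_le_add h2 h3
    _ = (√B + K) * I := by ring
    _ ≤ (√B + K) * (√c⁻¹ * √(∫ w, (P[fun w => δ (X w) | sigmaZ p q]) w ^ 2 ∂P)) := by gcongr
    _ = _ := by ring

end OLIVA

/-! ### Riesz representation and the conditional mean equation -/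

namespace OLIVA

variable {p q : ℕ} {P : Measure (Obs p q)}

theorem memLp_simpleFunc_comp_X [IsFiniteMeasure P] (f : SimpleFunc (Fin p → ℝ) ℝ) :
    MemLp (fun w => f (X w)) 2 P := by
  obtain ⟨C, hC⟩ := f.exists_forall_norm_le
  exact MemLp.of_bound (f.measurable.comp measurable_X).aestronglyMeasurable C
    (Eventually.of_forall fun w => hC _)

/-- The operator `δ ↦ E[δ(X) | Z]` on simple functions. -/
def condExpSimple (P : Measure (Obs p q)) [IsFiniteMeasure P] :
    SimpleFunc (Fin p → ℝ) ℝ →ₗ[ℝ] Lp ℝ 2 P where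
  toFun f := ((memLp_simpleFunc_comp_X f).condExp (m := sigmaZ p q) one_le_two).toLp
  map_add' f g := by
    rw [← MemLp.toLp_add, MemLp.toLp_eq_toLp_iff]
    exact condExp_add ((memLp_simpleFunc_comp_X f).integrable one_le_two)
      ((memLp_simpleFunc_comp_X g).integrable one_le_two) _
  map_smul' a f := by
    rw [RingHom.id_apply, ← MemLp.toLp_const_smul, MemLp.toLp_eq_toLp_iff]
    exact condExp_smul a (fun w => f (X w)) _

theorem coeFn_condExpSimple [IsFiniteMeasure P] (f : SimpleFunc (Fin p → ℝ) ℝ) :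
    condExpSimple P f =ᵐ[P] P[fun w => f (X w) | sigmaZ p q] :=
  MemLp.coeFn_toLp ((memLp_simpleFunc_comp_X f).condExp one_le_two)

theorem norm_condExpSimple [IsFiniteMeasure P] (f : SimpleFunc (Fin p → ℝ) ℝ) :
    ‖condExpSimple P f‖ = √(∫ w, (P[fun w => f (X w) | sigmaZ p q]) w ^ 2 ∂P) := by
  rw [← Real.sqrt_sq (norm_nonneg (condExpSimple P f)), ← real_inner_self_eq_norm_sq,
    L2.inner_def]
  congr 1
  refine integral_congr_ae ?_
  filter_upwards [coeFn_condExpSimple f] with w hw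
  simp [hw, sq]

/-- A regressor whose covariances `E[X_j δ(X)]` are dominated by `E[δ(X) | Z]` is the conditional
mean of a square integrable function of the instruments. -/
theorem exists_condExp_eq [IsProbabilityMeasure P] (j : Fin p)
    (hX : MemLp (fun w => X w j) 2 P) {K : ℝ}
    (hK : ∀ (δ : (Fin p → ℝ) → ℝ) (D : ℝ), Measurable δ → (∀ x, |δ x| ≤ D) →
      |∫ w, X w j * δ (X w) ∂P| ≤
        K * √(∫ w, (P[fun w => δ (X w) | sigmaZ p q]) w ^ 2 ∂P)) :
    ∃ φ : (Fin q → ℝ) → ℝ, Measurable φ ∧ MemLp φ 2 (P.map Z) ∧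
      P[fun w => φ (Z w) | sigmaX p q] =ᵐ[P] fun w => X w j := by
  let l : SimpleFunc (Fin p → ℝ) ℝ →ₗ[ℝ] ℝ :=
    { toFun := fun f => ∫ w, X w j * f (X w) ∂P
      map_add' := fun f g => by
        have hi : ∀ f : SimpleFunc (Fin p → ℝ) ℝ, Integrable (fun w => X w j * f (X w)) P :=
          fun f => hX.integrable_mul (memLp_simpleFunc_comp_X f)
        rw [← integral_add (hi f) (hi g)]
        simp only [SimpleFunc.coe_add, Pi.add_apply, mul_add]
      map_smul' := fun a f => by
        rw [RingHom.id_apply, smul_eq_mul, ← integral_const_mul]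
        simp only [SimpleFunc.coe_smul, Pi.smul_apply, smul_eq_mul, mul_left_comm] }
  obtain ⟨h, hh⟩ := exists_inner_eq_of_abs_le (condExpSimple P) l K (fun f => by
    obtain ⟨C, hC⟩ := f.exists_forall_norm_le
    rw [norm_condExpSimple]
    exact hK f C f.measurable hC)
  have hh2 : MemLp h 2 P := Lp.memLp h
  have hhi : Integrable h P := hh2.integrable one_le_two
  -- The representing vector lies in `L₂(P)` and need not depend on `Z` alone. It is only paired
  -- with functions of `Z`, so projecting it onto `Z` changes nothing.
  set r := P[h | sigmaZ p q] with hr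
  have hrZ : StronglyMeasurable[sigmaZ p q] r := stronglyMeasurable_condExp
  have hr2 : MemLp r 2 P := hh2.condExp one_le_two
  have hset : ∀ A, MeasurableSet[sigmaX p q] A → ∫ w in A, X w j ∂P = ∫ w in A, r w ∂P := by
    rintro _ ⟨B, hB, rfl⟩
    have hA : MeasurableSet ((X : Obs p q → _) ⁻¹' B) := measurable_X hB
    set f : SimpleFunc (Fin p → ℝ) ℝ := SimpleFunc.piecewise B hB 1 0 with hf
    have hfX : ∀ g : Obs p q → ℝ, (fun w => g w * f (X w)) = (X ⁻¹' B).indicator g := by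
      intro g
      funext w
      by_cases hw : X w ∈ B
      · rw [Set.indicator_of_mem (show w ∈ X ⁻¹' B from hw)]
        simp [hf, SimpleFunc.piecewise_apply, hw]
      · rw [Set.indicator_of_notMem (show w ∉ X ⁻¹' B from hw)]
        simp [hf, SimpleFunc.piecewise_apply, hw]
    have hf2 := memLp_simpleFunc_comp_X (P := P) f
    have hfi := hf2.integrable one_le_two
    set τ := P[fun w => f (X w) | sigmaZ p q] with hτ
    have hτZ : StronglyMeasurable[sigmaZ p q] τ := stronglyMeasurable_condExp
    have hτ2 : MemLp τ 2 P := hf2.condExp one_le_two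
    have e1 : ∫ w, X w j * f (X w) ∂P = ∫ w, h w * τ w ∂P := by
      rw [← show l f = ∫ w, X w j * f (X w) ∂P from rfl, ← hh f, L2.inner_def]
      refine integral_congr_ae ?_
      filter_upwards [coeFn_condExpSimple f] with w hw
      simp [hw, hτ, mul_comm]
    -- Self-adjointness of `E[· | Z]`, used here to replace `h` by `r` and in `e3` to replace
    -- `E[f(X) | Z]` by `f(X)`.
    have e2 : ∫ w, h w * τ w ∂P = ∫ w, r w * τ w ∂P := by
      rw [← integral_condExp (sigmaZ_le (p := p) (q := q))]
      exact integral_congr_ae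
        (condExp_mul_of_stronglyMeasurable_right hτZ (hh2.integrable_mul hτ2) hhi)
    have e3 : ∫ w, r w * f (X w) ∂P = ∫ w, r w * τ w ∂P := by
      rw [← integral_condExp (sigmaZ_le (p := p) (q := q))]
      exact integral_congr_ae
        (condExp_mul_of_stronglyMeasurable_left hrZ (hr2.integrable_mul hf2) hfi)
    rw [← integral_indicator hA, ← integral_indicator hA, ← hfX, ← hfX, e1, e2, e3]
  have hXm : StronglyMeasurable[sigmaX p q] fun w : Obs p q => X w j :=
    ((measurable_pi_apply j).comp (comap_measurable X)).stronglyMeasurable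
  have hce : (fun w => X w j) =ᵐ[P] P[r | sigmaX p q] :=
    ae_eq_condExp_of_forall_setIntegral_eq sigmaX_le (hr2.integrable one_le_two)
      (fun _ _ _ => (hX.integrable one_le_two).integrableOn) (fun A hA _ => hset A hA)
      hXm.aestronglyMeasurable
  obtain ⟨φ, hφ, hφr⟩ := hrZ.exists_eq_measurable_comp
  refine ⟨φ, hφ.measurable, ?_, ?_⟩
  · rw [memLp_map_measure_iff hφ.aestronglyMeasurable measurable_Z.aemeasurable, ← hφr]
    exact hr2
  · have : (fun w => φ (Z w)) = r := hφr.symm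
    rw [this]
    exact hce.symm

end OLIVA

end

/-! ### The main theorem -/

theorem lemma1 {p q : ℕ} (P : Measure (OLIVA.Obs p q)) (g g₀ : (Fin p → ℝ) → ℝ)
    (hmodel : OLIVA.InModel P g)
    (hg₀ : OLIVA.IsMinNormSolution P g₀)
    (hvar : OLIVA.BoundedCondVariance P g₀)
    (hT : IsCompactOperator (OLIVA.T P))
    (hreg : OLIVA.RegularlyIdentified P g₀) :
    ∃ h : (Fin q → ℝ) → Fin p → ℝ, Measurable h ∧
      (∀ j, MemLp (fun z => h z j) 2 (P.map OLIVA.Z)) ∧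
      ∀ j, P[fun w => h (OLIVA.Z w) j | OLIVA.sigmaX p q] =ᵐ[P] fun w => OLIVA.X w j := by
  have := hmodel.isProbabilityMeasure
  have hm₀ : OLIVA.InModel P g₀ := { hmodel with solves := hg₀.solves }
  -- The kick map evaluates the structural function pointwise and has to be measurable, so `g₀` is
  -- replaced by a measurable version; the hypotheses used below carry over.
  obtain ⟨G, hG, hae⟩ := hg₀.solves.memLp.aestronglyMeasurable.aemeasurable
  have haeX : ∀ᵐ w ∂P, g₀ (OLIVA.X w) = G (OLIVA.X w) :=
    ae_of_ae_map OLIVA.measurable_X.aemeasurable hae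
  have hmG : OLIVA.InModel P G :=
    { hmodel with
      solves :=
        { memLp := (memLp_congr_ae hae).1 hg₀.solves.memLp
          condExp_eq := hg₀.solves.condExp_eq.trans (condExp_congr_ae haeX) } }
  have hvarG : OLIVA.BoundedCondVariance P G := by
    obtain ⟨c, C, hc, h⟩ := hvar
    have hcong : P[fun w => (OLIVA.Y w - g₀ (OLIVA.X w)) ^ 2 | OLIVA.sigmaZ p q] =ᵐ[P]
        P[fun w => (OLIVA.Y w - G (OLIVA.X w)) ^ 2 | OLIVA.sigmaZ p q] :=
      condExp_congr_ae (haeX.mono fun w hw => by simp only [hw])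
    refine ⟨c, C, hc, ?_⟩
    filter_upwards [h, hcong] with w h1 h2
    rwa [← h2]
  have hfin : ∀ c, OLIVA.efficiencyBound P G c < ⊤ := fun c =>
    (OLIVA.efficiencyBound_le_of_ae_eq hm₀ hae c).trans_lt (hreg.finite_bound c)
  have hex : ∀ j, ∃ φ : (Fin q → ℝ) → ℝ, Measurable φ ∧ MemLp φ 2 (P.map OLIVA.Z) ∧
      P[fun w => φ (OLIVA.Z w) | OLIVA.sigmaX p q] =ᵐ[P] fun w => OLIVA.X w j := fun j => by
    obtain ⟨K, hK⟩ := OLIVA.exists_abs_integral_le (q := q) hG hmG hvarG hfin j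
    exact OLIVA.exists_condExp_eq j (hmodel.memLp_X j) hK
  choose φ hφ hφ2 hφX using hex
  exact ⟨fun z j => φ j z, measurable_pi_iff.2 hφ, hφ2, hφX⟩
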